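/- **Anthill Python.** Types are $A ::= \star \mid \mathsf{int} \mid \overline{A}\to A \mid \mathsf{class}(q,\Delta_1,\Delta_2,\overline{A}) \mid \mathsf{obj}(q,\Delta)$, where $q\in\{\lozenge,\blacklozenge\}$ (open, closed) and an attribute type $\Delta$ is a finite partial map from labels to types ($\Delta_1$: class attributes, $\Delta_2$: instance attributes, $\overline A$: constructor parameters without the receiver). Terms are variables, integers, $t(\overline t)$, $t.\ell$, $t.\ell=t$, $\mathtt{let}\ x=t\ \mathtt{in}\ t$, $\lambda(\overline{x{:}A})\to A.\,t$, and class expressions with annotation $(q,\Delta_1,\Delta_2)$, superclasses $\overline t$, methods (explicit untyped receiver $x_s$, typed parameters, return type, body), fields, and a constructor (receiver $x_s$, typed parameters, body). **μPython.** Expressions are $e ::= x \mid n \mid a \mid e(\overline e)^p \mid e.\ell^p \mid e.\ell^p=e \mid \mathtt{let}\ x=e\ \mathtt{in}\ e \mid \mathsf{class}^p(\overline e)\{\overline{\ell=e}\}\,e \mid \lambda\overline x.e \mid e{\Downarrow}S$, with heap addresses $a$ and origin labels $p\in\{\circ,\bullet\}$ ($\circ$: translated from Anthill; $\bullet$: untyped);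 the last component of a class expression is its constructor. Tags are $S ::= \mathsf{pyobj}\mid\mathsf{int}\mid {\to}n \mid \mathsf{class}(\delta,C)\mid\mathsf{obj}(\delta)$, where $\delta$ is a finite set of labels and $C$ is a number or $\mathsf{Any}$. Put $\lfloor\star\rfloor=\mathsf{pyobj}$, $\lfloor\mathsf{int}\rfloor=\mathsf{int}$, $\lfloor\overline A\to A'\rfloor={\to}|\overline A|$, $\lfloor\mathsf{obj}(q,\Delta)\rfloor=\mathsf{obj}(\mathrm{dom}\,\Delta)$, $\lfloor\mathsf{class}(q,\Delta_1,\Delta_2,\overline A)\rfloor=\mathsf{class}(\mathrm{dom}\,\Delta_1,|\overline A|)$, and define $\lfloor\Gamma\rfloor$ pointwise. **Relations on Anthill types.** $\sim$ is consistency: $\star\sim A\sim\star$, $\mathsf{int}\sim\mathsf{int}$, and congruence for functions (equal arity), objects and classes, attribute types being compared on common labels. $\Delta_1\lesssim\Delta_2$ means that each $x\in\mathrm{dom}\,\Delta_2$ is in $\mathrm{dom}\,\Delta_1$ with $\Delta_1(x)\sim\Delta_2(x)$. Subtype-consistency $\lesssim$ on types has $\star\lesssim A\lesssim\star$ and $\mathsf{int}\lesssim\mathsf{int}$,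 is contravariant in parameters (equal arity) and covariant in results, compares the attribute types of objects, and those of classes, by $\lesssim$ (with contravariant constructor parameters), and has $\mathsf{class}(q,\Delta_1,\Delta_2,\overline A)\lesssim\mathsf{obj}(q',\Delta_3)$ if $\Delta_1\lesssim\Delta_3$, and $\mathsf{class}(q,\Delta_1,\Delta_2,\overline A)\lesssim\overline B\to B'$ if $\overline{B\lesssim A}$ and $\mathsf{obj}(q,\mathit{inst}(\Delta_1,\Delta_2))\lesssim B'$. Here $\mathit{inst}(\Delta_1,\Delta_2)$ is $\Delta_1$ with the first parameter of every function type dropped, together with the bindings of $\Delta_2$ outside $\mathrm{dom}\,\Delta_1$. Also $\mathit{mems}(\star)=\emptyset$, $\mathit{mems}(\mathsf{obj}(q,\Delta))=\Delta$, $\mathit{mems}(\mathsf{class}(q,\Delta_1,\Delta_2,\overline A))=\Delta_1$ (undefined otherwise); $\star$ is open, and $\mathsf{obj}(q,\dots)$, $\mathsf{class}(q,\dots)$ are open iff $q=\lozenge$. **Translation $\Gamma\vdash t\leadsto e:A$.** Variables, integers and $\mathtt{let}$ translate homomorphically. All labels produced are $\circ$. Let $t\leadsto e:A_1$, $t_i\leadsto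 e_i:A'_i$, $\Delta=\mathit{mems}(A_1)$. - $t.\ell\leadsto(e.\ell){\Downarrow}\lfloor A_2\rfloor:A_2$ if $\Delta(\ell)=A_2$; $t.\ell\leadsto(e{\Downarrow}\mathsf{obj}(\{\ell\})).\ell:\star$ if $\ell\notin\mathrm{dom}\,\Delta$ and $A_1$ is open. - $t.\ell=t_2\leadsto e.\ell=(e_2{\Downarrow}\lfloor A_2\rfloor):\mathsf{int}$ if $\Delta(\ell)=A_2$ and $A_2'\lesssim A_2$; $t.\ell=t_2\leadsto(e{\Downarrow}\mathsf{obj}(\emptyset)).\ell=e_2:\mathsf{int}$ if $\ell\notin\mathrm{dom}\,\Delta$ and $A_1$ is open. - $t(\overline{t_i})\leadsto(e{\Downarrow}{\to}|\overline{t_i}|)(\overline{e_i}):\star$ if $A_1=\star$; $t(\overline{t_i})\leadsto e(\overline{e_i}){\Downarrow}\lfloor A_2\rfloor:A_2$ if $A_1=\overline B\to A_2$, or $A_1=\mathsf{class}(q,\Delta_1,\Delta_2,\overline B)$ and $A_2=\mathsf{obj}(q,\mathit{inst}(\Delta_1,\Delta_2))$, where in both cases the arity matches and $\overline{A_i'\lesssim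 B_i}$. - $\lambda(\overline{x{:}B})\to A_2.t\leadsto\lambda\overline x.\,\overline{\mathtt{let}\ x=x{\Downarrow}\lfloor B\rfloor\ \mathtt{in}}\ e:\overline B\to A_2$ if $\Gamma,\overline{x{:}B}\vdash t\leadsto e:A_2'$ and $A_2'\lesssim A_2$. - A constructor becomes $\lambda x_s,\overline x.\,\overline{\mathtt{let}\ x=x{\Downarrow}\lfloor B\rfloor\ \mathtt{in}}\ e$ with parameter types $\overline B$, its body being translated under $\Gamma,x_s{:}\star,\overline{x{:}B}$. A method of a class of type $\mathsf{class}(q,\Delta_1,\Delta_2,\overline{A_c})$ becomes $\lambda x_s,\overline x.\,\mathtt{let}\ x_s=x_s{\Downarrow}\lfloor A_o\rfloor\ \mathtt{in}\ \overline{\mathtt{let}\ x=x{\Downarrow}\lfloor B\rfloor\ \mathtt{in}}\ e$ at type $\overline B\to A_2$, with $A_o=\mathsf{obj}(q,\mathit{inst}(\Delta_1,\Delta_2))$, its body being translated under $\Gamma,x_s{:}A_o,\overline{x{:}B}$ at a type $\lesssim A_2$. - A class with annotation $(q,\Delta_1,\Delta_2)$ becomes the class expression with translated constructor (parameter types $\overline{A_c}$),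 members the translated methods and fields, and each superclass $t_s\leadsto e_s:A_s$ replaced by $e_s{\Downarrow}\mathsf{class}(\mathrm{dom}\,\mathit{mems}(A_s),\mathsf{Any})$. Its type is $\mathsf{class}(q,\Delta_1,\Delta_2,\overline{A_c})$. Required: every $x\in\mathrm{dom}\,\Delta_1$ is bound, by a field, a method or some $\mathit{mems}(A_s)$, to a type $\lesssim\Delta_1(x)$. **Evaluation.** Values $v$ are integers, addresses and functions. A heap $\mu$ is a finite map from addresses to classes $\mathsf{class}(\overline a)\{M\}v$ and objects $\mathsf{obj}(a)\{M\}$, where $a$ is the class of the object and $M$ maps labels to values. $\mathit{getattr}(a,\ell,\mu)$ looks for $\ell$ in the $M$ at $a$, then in the class of an object, or in the superclasses of a class, depth first and from left to right. $\mathit{hasattrs}(a,\delta,\mu)$ says that it is defined for all $\ell\in\delta$. $\mathit{pm}(v,\mu,C)$ holds for a function if $C=\mathsf{Any}$ or $C$ is its number of parameters, and for the address of a class with constructor $v'$ if $C=\mathsf{Any}$ or $\mathit{pm}(v',\mu,C+1)$. $\mathit{check}(v,\mu,S)$: always for $\mathsf{pyobj}$; integers for $\mathsf{int}$; addresses with $\mathit{hasattrs}(v,\delta,\mu)$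 for $\mathsf{obj}(\delta)$; functions and addresses of classes with $\mathit{pm}(v,\mu,n)$ for ${\to}n$; addresses of classes with $\mathit{pm}(v,\mu,C)$ and $\mathit{hasattrs}(v,\delta,\mu)$ for $\mathsf{class}(\delta,C)$. Reduction $\longrightarrow$ of redexes: - $v{\Downarrow}S$ gives $v$ if $\mathit{check}(v,\mu,S)$ and $\mathtt{casterror}$ otherwise; $\mathtt{let}$ substitutes. - $v(\overline v)^p$ substitutes if $v$ is a function of the right arity; if $v=a$ is a class with constructor $v'$, it allocates $a'\mapsto\mathsf{obj}(a)\{\}$ at a fresh $a'$ and gives $\mathtt{let}\ \_=v'(a',\overline v)^p\ \mathtt{in}\ a'$; otherwise it gives $\mathtt{pyerror}(p)$. - A class expression labelled $p$ allocates a class at a fresh address if its superclasses are addresses of classes and its constructor satisfies $\mathit{pm}(\cdot,\mu,\mathsf{Any})$, and gives $\mathtt{pyerror}(p)$ otherwise. - $a.\ell^p$ gives $\mathit{getattr}(a,\ell,\mu)$, except that when $a$ is an object without own attribute $\ell$ and the result is a function $v=\lambda\overline x.e$, it gives $\lambda\overline y.v(a,\overline y)^p$ with $|\overline y|=|\overline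 x|-1$, or $\mathtt{casterror}$ if $|\overline x|=0$. It gives $\mathtt{pyerror}(p)$ if this is undefined or the subject is not an address. - $a.\ell^p=v$ updates the $M$ at $a$ and gives $0$, or $\mathtt{pyerror}(p)$ if the subject is not an address in the heap. The step relation $\longmapsto$ applies $\longrightarrow$ under call-by-value, left-to-right evaluation contexts (in a class expression: superclasses, then constructor, then members); errors discard the context. $\longrightarrow^*$ denotes reduction in finitely many steps $\longmapsto$. **Tag typing $\Gamma;\Sigma\vdash e:S$.** Subtyping is the transitive relation generated by $S<:\mathsf{pyobj}$, $\mathsf{int}<:\mathsf{int}$, $\mathsf{obj}(\delta)<:\mathsf{obj}(\delta')$ and $\mathsf{class}(\delta,C)<:\mathsf{class}(\delta',C)$ for $\delta'\subseteq\delta$, $\mathsf{class}(\delta,n)<:\mathsf{class}(\delta,\mathsf{Any})$, $\mathsf{class}(\delta,C)<:\mathsf{obj}(\delta)$, $\mathsf{class}(\delta,n)<:{\to}n$. Typing has subsumption; variables and addresses have their tags in $\Gamma$ and $\Sigma$, integers have $\mathsf{int}$; $\mathtt{let}$ is standard; $\lambda\overline x.e:{\to}|\overline x|$ if $e:\mathsf{pyobj}$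 under $\Gamma,\overline{x{:}\mathsf{pyobj}}$; $e{\Downarrow}S:S$ if $e:\mathsf{pyobj}$. Applications and reads have tag $\mathsf{pyobj}$ and writes $\mathsf{int}$. A $\bullet$-node requires $\mathsf{pyobj}$ of all its parts, and a $\bullet$-class with member labels $\overline\ell$ has tag $\mathsf{class}(\overline\ell,\mathsf{Any})$. A $\circ$-call of $n$ arguments requires callee ${\to}n$, a $\circ$-read of $\ell$ requires subject $\mathsf{obj}(\{\ell\})$, a $\circ$-write requires subject $\mathsf{obj}(\emptyset)$, and a $\circ$-class requires superclasses $\mathsf{class}(\delta_i,\mathsf{Any})$ and constructor ${\to}(n+1)$ and has tag $\mathsf{class}(\overline\ell\cup\bigcup_i\delta_i,n)$; their other parts are required to have tag $\mathsf{pyobj}$. $\Sigma\vdash\mu$ means: $\mathrm{dom}\,\Sigma=\mathrm{dom}\,\mu$, and each $a$ is in $\mu$ either a class with $\Sigma(a)=\mathsf{class}(\delta,C)$ and $\mathit{pm}(a,\mu,C)$, or an object with $\Sigma(a)=\mathsf{obj}(\delta)$, where in both cases $\mathit{hasattrs}(a,\delta,\mu)$, the superclasses (resp. the class) of $a$ have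 class tags in $\Sigma$, and the attribute values (and the constructor) have tag $\mathsf{pyobj}$ under $\emptyset;\Sigma$. **Untyped contexts.** $\mathcal C$ ranges over expressions with one hole, such that the nodes above the hole that carry a label are all labelled $\bullet$; $\mathcal C[e]$ is capturing replacement of the hole. $\mathcal C:\Gamma;S\Rightarrow\Gamma';S'$ is generated by $\square:\Gamma;S\Rightarrow\Gamma;S$, subsumption, and the typing rules above for $\mathtt{let}$, $\lambda$, ${\Downarrow}$ and the $\bullet$-nodes (with empty $\Sigma$), a class context having tag $\mathsf{pyobj}$. **Theorem 1 (Open world soundness).** If $\Gamma\vdash t\leadsto e:A$, then for every $S$ and every context $\mathcal C:\lfloor\Gamma\rfloor;\lfloor A\rfloor\Rightarrow\emptyset;S$ we have $\emptyset;\emptyset\vdash\mathcal C[e]:S$, and at least one of the following holds: 1. for some $v,\Sigma,\mu$: $\mathcal C[e]\mid\emptyset\longrightarrow^* v\mid\mu$, $\emptyset;\Sigma\vdash v:S$ and $\Sigma\vdash\mu$; 2. $\mathcal C[e]\mid\emptyset\longrightarrow^*\mathtt{pyerror}(\bullet)$; 3. $\mathcal C[e]\mid\emptyset\longrightarrow^*\mathtt{casterror}$;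 4. (divergence) every $r$ with $\mathcal C[e]\mid\emptyset\longrightarrow^* r$ is of the form $e'\mid\mu'$ and there is $r'$ with $e'\mid\mu'\longmapsto r'$. Moreover $\mathcal C[e]\mid\emptyset\longrightarrow^*\mathtt{pyerror}(\circ)$ never holds. -/

import Mathlib

namespace Anthill

/-! ### Names, origins, environments -/

/-- Program variables. -/
abbrev Var := ℕ
/-- Attribute names. -/
abbrev Label := ℕ
/-- Heap addresses. -/
abbrev Addr := ℕ

/-- Origin labels: `typed` is `∘` (code translated from Anthill),
`untyped` is `•` (native μPython code). -/
inductive Origin where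
  | typed
  | untyped

/-- Typing environments: partial maps from variables. -/
abbrev Env (α : Type) := Var → Option α

namespace Env

/-- The empty environment. -/
def empty {α : Type} : Env α := fun _ => none

/-- `Γ, x:A`. -/
def bind {α : Type} (Γ : Env α) (x : Var) (A : α) : Env α :=
  fun y => if y = x then some A else Γ y

/-- `Γ, x₁:A₁, …, xₙ:Aₙ`; later entries shadow earlier ones. -/
def extend {α : Type} (Γ : Env α) : List (Var × α) → Env α
  | [] => Γ
  | (x, A) :: ps => (Γ.bind x A).extend ps

end Env

/-! ### Anthill types -/

/-- Openness descriptors: `opened` is `◇`, `closed` is `◆`. -/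
inductive Openness where
  | opened
  | closed

/-- Anthill types. Attribute types `Δ` are association lists, read as partial maps through
`List.lookup`. -/
inductive Ty where
  | dyn
  | int
  | fn (params : List Ty) (ret : Ty)
  | cls (q : Openness) (attrs inst : List (Label × Ty)) (params : List Ty)
  | obj (q : Openness) (attrs : List (Label × Ty))

/-- Attribute types `Δ`. -/
abbrev Attrs := List (Label × Ty)

/-- `dom(Δ)`, which is also `⌊Δ⌋`. -/
def Attrs.dom (Δ : Attrs) : Finset Label := (Δ.map Prod.fst).toFinset

/-- `mems(A)`, a partial function. -/
def Ty.mems : Ty → Option Attrs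
  | .dyn => some []
  | .obj _ Δ => some Δ
  | .cls _ Δ₁ _ _ => some Δ₁
  | .int => none
  | .fn _ _ => none

/-- `queryable(A)`, a partial function. -/
def Ty.queryable : Ty → Option Openness
  | .dyn => some .opened
  | .obj q _ => some q
  | .cls q _ _ _ => some q
  | .int => none
  | .fn _ _ => none

/-- `inst-fun(A)`: drop the receiver from a function type. -/
def Ty.instFun : Ty → Ty
  | .fn As A => .fn As.tail A
  | A => A

/-- `instantiate(Δ₁, Δ₂)`. -/
def Attrs.instantiate (Δ₁ Δ₂ : Attrs) : Attrs :=
  Δ₁.map (fun p => (p.1, p.2.instFun)) ++ Δ₂.filter (fun p => p.1 ∉ Attrs.dom Δ₁)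

/-- Consistency `A ∼ B`. -/
inductive Consistent : Ty → Ty → Prop where
  | dynL (A : Ty) : Consistent .dyn A
  | dynR (A : Ty) : Consistent A .dyn
  | int : Consistent .int .int
  | obj {q₁ q₂ : Openness} {Δ₁ Δ₂ : Attrs} :
      (∀ x A B, Δ₁.lookup x = some A → Δ₂.lookup x = some B → Consistent A B) →
      Consistent (.obj q₁ Δ₁) (.obj q₂ Δ₂)
  | cls {q₁ q₂ : Openness} {Δ₁ Δ₂ Δ₃ Δ₄ : Attrs} {As Bs : List Ty} :
      (∀ x A B, Δ₁.lookup x = some A → Δ₃.lookup x = some B → Consistent A B) →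
      (∀ x A B, Δ₂.lookup x = some A → Δ₄.lookup x = some B → Consistent A B) →
      As.length = Bs.length →
      (∀ (i : ℕ) (hA : i < As.length) (hB : i < Bs.length), Consistent As[i] Bs[i]) →
      Consistent (.cls q₁ Δ₁ Δ₂ As) (.cls q₂ Δ₃ Δ₄ Bs)
  | fn {As Bs : List Ty} {A B : Ty} :
      As.length = Bs.length →
      (∀ (i : ℕ) (hA : i < As.length) (hB : i < Bs.length), Consistent As[i] Bs[i]) →
      Consistent A B → Consistent (.fn As A) (.fn Bs B)

/-- `Δ₁ ≲ Δ₂`: every attribute of `Δ₂` occurs in `Δ₁` at a consistent type. -/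
def Attrs.SubConsistent (Δ₁ Δ₂ : Attrs) : Prop :=
  ∀ x B, Δ₂.lookup x = some B → ∃ A, Δ₁.lookup x = some A ∧ Consistent A B

/-- Subtype-consistency `A ≲ B`. -/
inductive SubConsistent : Ty → Ty → Prop where
  | dynL (A : Ty) : SubConsistent .dyn A
  | dynR (A : Ty) : SubConsistent A .dyn
  | int : SubConsistent .int .int
  | fn {As Bs : List Ty} {A B : Ty} :
      As.length = Bs.length →
      (∀ (i : ℕ) (hA : i < As.length) (hB : i < Bs.length), SubConsistent Bs[i] As[i]) →
      SubConsistent A B → SubConsistent (.fn As A) (.fn Bs B)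
  | obj {q₁ q₂ : Openness} {Δ₁ Δ₂ : Attrs} :
      Δ₁.SubConsistent Δ₂ → SubConsistent (.obj q₁ Δ₁) (.obj q₂ Δ₂)
  | cls {q₁ q₂ : Openness} {Δ₁ Δ₂ Δ₃ Δ₄ : Attrs} {As Bs : List Ty} :
      Δ₁.SubConsistent Δ₃ → Δ₂.SubConsistent Δ₄ →
      As.length = Bs.length →
      (∀ (i : ℕ) (hA : i < As.length) (hB : i < Bs.length), SubConsistent Bs[i] As[i]) →
      SubConsistent (.cls q₁ Δ₁ Δ₂ As) (.cls q₂ Δ₃ Δ₄ Bs)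
  | clsObj {q₁ q₂ : Openness} {Δ₁ Δ₂ Δ₃ : Attrs} {As : List Ty} :
      Δ₁.SubConsistent Δ₃ → SubConsistent (.cls q₁ Δ₁ Δ₂ As) (.obj q₂ Δ₃)
  | clsFn {q : Openness} {Δ₁ Δ₂ : Attrs} {As Bs : List Ty} {B : Ty} :
      As.length = Bs.length →
      (∀ (i : ℕ) (hA : i < As.length) (hB : i < Bs.length), SubConsistent Bs[i] As[i]) →
      SubConsistent (.obj q (Δ₁.instantiate Δ₂)) B →
      SubConsistent (.cls q Δ₁ Δ₂ As) (.fn Bs B)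

/-! ### Anthill terms -/

mutual

/-- Anthill terms. -/
inductive Term where
  | var (x : Var)
  | num (n : ℤ)
  | app (t : Term) (args : List Term)
  | get (t : Term) (l : Label)
  | set (t : Term) (l : Label) (t' : Term)
  | letIn (x : Var) (t t' : Term)
  | cls (q : Openness) (attrs inst : Attrs) (supers : List Term)
      (methods : List (Label × Method)) (fields : List (Label × Term)) (ctor : Ctor)
  | fn (params : List (Var × Ty)) (ret : Ty) (body : Term)

/-- Methods, with an explicit receiver and a return type. -/
inductive Method where
  | mk (self : Var) (params : List (Var × Ty)) (ret : Ty) (body : Term)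

/-- Constructors, with an explicit receiver and no return type. -/
inductive Ctor where
  | mk (self : Var) (params : List (Var × Ty)) (body : Term)

end

/-! ### μPython with origin labels -/

/-- Arity part `C` of class tags: a number or `Any`. -/
inductive Arity where
  | num (n : ℕ)
  | any

/-- Type tags `S`. -/
inductive Tag where
  | pyobj
  | int
  | fn (n : ℕ)
  | cls (δ : Finset Label) (C : Arity)
  | obj (δ : Finset Label)

/-- `⌊A⌋`. -/
def Ty.tag : Ty → Tag
  | .dyn => .pyobj
  | .int => .int
  | .fn As _ => .fn As.length
  | .cls _ Δ₁ _ As => .cls (Attrs.dom Δ₁) (.num As.length)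
  | .obj _ Δ => .obj (Attrs.dom Δ)

/-- `⌊Γ⌋`. -/
def Env.tags (Γ : Env Ty) : Env Tag := fun x => (Γ x).map Ty.tag

/-- μPython expressions with origin labels. -/
inductive Expr where
  | var (x : Var)
  | num (n : ℤ)
  | addr (a : Addr)
  | app (e : Expr) (args : List Expr) (p : Origin)
  | get (e : Expr) (l : Label) (p : Origin)
  | set (e : Expr) (l : Label) (p : Origin) (e' : Expr)
  | letIn (x : Var) (e e' : Expr)
  | cls (supers : List Expr) (members : List (Label × Expr)) (ctor : Expr) (p : Origin)
  | fn (params : List Var) (body : Expr)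
  | check (e : Expr) (S : Tag)

/-- Values: numbers, addresses and functions. -/
inductive Expr.IsValue : Expr → Prop where
  | num (n : ℤ) : IsValue (.num n)
  | addr (a : Addr) : IsValue (.addr a)
  | fn (xs : List Var) (e : Expr) : IsValue (.fn xs e)

/-- The subtype of values. -/
abbrev Value := {e : Expr // e.IsValue}

/-- A labelled list of values, as class members. -/
def valueMembers (M : List (Label × Value)) : List (Label × Expr) :=
  M.map (fun p => (p.1, p.2.1))

/-! ### Substitution

Values are only ever substituted into the bodies of closed programs, so they are closed and no
renaming of bound variables is needed. -/

/-- Simultaneous substitutions of values for variables. -/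
abbrev Subst := Var → Option Value

/-- Remove the variables `xs` from a substitution. -/
def Subst.remove (σ : Subst) (xs : List Var) : Subst :=
  fun y => if y ∈ xs then none else σ y

mutual

/-- Apply a substitution to an expression. -/
def Expr.subst (σ : Subst) : Expr → Expr
  | .var x => match σ x with
    | some v => v.1
    | none => .var x
  | .num n => .num n
  | .addr a => .addr a
  | .app e es p => .app (e.subst σ) (Expr.substList σ es) p
  | .get e l p => .get (e.subst σ) l p
  | .set e l p e' => .set (e.subst σ) l p (e'.subst σ)
  | .letIn x e e' => .letIn x (e.subst σ) (e'.subst (σ.remove [x]))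
  | .cls ss ms c p => .cls (Expr.substList σ ss) (Expr.substMembers σ ms) (c.subst σ) p
  | .fn xs e => .fn xs (e.subst (σ.remove xs))
  | .check e S => .check (e.subst σ) S

/-- Apply a substitution to a list of expressions. -/
def Expr.substList (σ : Subst) : List Expr → List Expr
  | [] => []
  | e :: es => e.subst σ :: Expr.substList σ es

/-- Apply a substitution to a list of labelled expressions. -/
def Expr.substMembers (σ : Subst) : List (Label × Expr) → List (Label × Expr)
  | [] => []
  | (l, e) :: ms => (l, e.subst σ) :: Expr.substMembers σ ms

end

/-- The substitution `[x̄/v̄]`. -/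
def Subst.ofLists (xs : List Var) (vs : List Value) : Subst :=
  Env.extend Env.empty (xs.zip vs)

/-! ### Translation from Anthill to μPython -/

/-- `let x₁ = x₁⇓⌊A₁⌋ in … let xₙ = xₙ⇓⌊Aₙ⌋ in e`. -/
def checkParams : List (Var × Ty) → Expr → Expr
  | [], e => e
  | (x, A) :: ps, e => .letIn x (.check (.var x) A.tag) (checkParams ps e)

mutual

/-- `Γ ⊢ t ⇝ e : A`. -/
inductive Translates : Env Ty → Term → Expr → Ty → Prop where
  | var {Γ : Env Ty} {x : Var} {A : Ty} : Γ x = some A → Translates Γ (.var x) (.var x) A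
  | num {Γ : Env Ty} {n : ℤ} : Translates Γ (.num n) (.num n) .int
  | letIn {Γ : Env Ty} {x : Var} {t₁ t₂ : Term} {e₁ e₂ : Expr} {A₁ A₂ : Ty} :
      Translates Γ t₁ e₁ A₁ → Translates (Γ.bind x A₁) t₂ e₂ A₂ →
      Translates Γ (.letIn x t₁ t₂) (.letIn x e₁ e₂) A₂
  | get {Γ : Env Ty} {t : Term} {e : Expr} {A₁ A₂ : Ty} {Δ : Attrs} {l : Label} :
      Translates Γ t e A₁ → A₁.mems = some Δ → Δ.lookup l = some A₂ →
      Translates Γ (.get t l) (.check (.get e l .typed) A₂.tag) A₂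
  | getCheck {Γ : Env Ty} {t : Term} {e : Expr} {A₁ : Ty} {Δ : Attrs} {l : Label} :
      Translates Γ t e A₁ → A₁.mems = some Δ → l ∉ Δ.dom → A₁.queryable = some .opened →
      Translates Γ (.get t l) (.get (.check e (.obj {l})) l .typed) .dyn
  | set {Γ : Env Ty} {t₁ t₂ : Term} {e₁ e₂ : Expr} {A₁ A₂ A₂' : Ty} {Δ : Attrs} {l : Label} :
      Translates Γ t₁ e₁ A₁ → Translates Γ t₂ e₂ A₂' → A₁.mems = some Δ →
      Δ.lookup l = some A₂ → SubConsistent A₂' A₂ →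
      Translates Γ (.set t₁ l t₂) (.set e₁ l .typed (.check e₂ A₂.tag)) .int
  | setCheck {Γ : Env Ty} {t₁ t₂ : Term} {e₁ e₂ : Expr} {A₁ A₂ : Ty} {Δ : Attrs} {l : Label} :
      Translates Γ t₁ e₁ A₁ → Translates Γ t₂ e₂ A₂ → A₁.mems = some Δ →
      l ∉ Δ.dom → A₁.queryable = some .opened →
      Translates Γ (.set t₁ l t₂) (.set (.check e₁ (.obj ∅)) l .typed e₂) .int
  | fn {Γ : Env Ty} {ps : List (Var × Ty)} {A₂ A₂' : Ty} {t : Term} {e : Expr} :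
      Translates (Γ.extend ps) t e A₂' → SubConsistent A₂' A₂ →
      Translates Γ (.fn ps A₂ t) (.fn (ps.map Prod.fst) (checkParams ps e))
        (.fn (ps.map Prod.snd) A₂)
  | appDyn {Γ : Env Ty} {t : Term} {ts : List Term} {e : Expr} {es : List Expr}
      {As : List Ty} :
      Translates Γ t e .dyn → TranslatesList Γ ts es As →
      Translates Γ (.app t ts) (.app (.check e (.fn As.length)) es .typed) .dyn
  | appFn {Γ : Env Ty} {t : Term} {ts : List Term} {e : Expr} {es : List Expr}
      {As As' : List Ty} {A₂ : Ty} :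
      Translates Γ t e (.fn As A₂) → TranslatesList Γ ts es As' →
      As.length = ts.length →
      (∀ (i : ℕ) (h' : i < As'.length) (h : i < As.length), SubConsistent As'[i] As[i]) →
      Translates Γ (.app t ts) (.check (.app e es .typed) A₂.tag) A₂
  | appCtor {Γ : Env Ty} {t : Term} {ts : List Term} {e : Expr} {es : List Expr}
      {q : Openness} {Δ₁ Δ₂ : Attrs} {As As' : List Ty} {A₂ : Ty} :
      Translates Γ t e (.cls q Δ₁ Δ₂ As) → TranslatesList Γ ts es As' →
      As.length = ts.length →
      (∀ (i : ℕ) (h' : i < As'.length) (h : i < As.length), SubConsistent As'[i] As[i]) →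
      A₂ = .obj q (Δ₁.instantiate Δ₂) →
      Translates Γ (.app t ts) (.check (.app e es .typed) A₂.tag) A₂
  | cls {Γ : Env Ty} {q : Openness} {Δ₁ Δ₂ : Attrs} {ts : List Term} {es : List Expr}
      {As : List Ty} {Δs : List Attrs} {ms : List (Label × Method)}
      {ems : List (Label × Expr)} {Ams : List (Label × Ty)} {fs : List (Label × Term)}
      {efs : List (Label × Expr)} {Afs : List (Label × Ty)} {c : Ctor} {ec : Expr}
      {Acs : List Ty} :
      TranslatesList Γ ts es As →
      TranslatesCtor Γ c ec Acs →
      TranslatesMethods Γ (.cls q Δ₁ Δ₂ Acs) ms ems Ams →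
      TranslatesFields Γ fs efs Afs →
      As.map Ty.mems = Δs.map some →
      (∀ x B, Δ₁.lookup x = some B → ∃ B',
        ((x, B') ∈ Afs ∨ (x, B') ∈ Ams ∨ ∃ Δ ∈ Δs, Δ.lookup x = some B') ∧
          SubConsistent B' B) →
      Translates Γ (.cls q Δ₁ Δ₂ ts ms fs c)
        (.cls (List.zipWith (fun e Δ => .check e (.cls (Attrs.dom Δ) .any)) es Δs)
          (ems ++ efs) ec .typed)
        (.cls q Δ₁ Δ₂ Acs)

/-- The translation of a sequence of terms, pointwise. -/
inductive TranslatesList : Env Ty → List Term → List Expr → List Ty → Prop where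
  | nil {Γ : Env Ty} : TranslatesList Γ [] [] []
  | cons {Γ : Env Ty} {t : Term} {e : Expr} {A : Ty} {ts : List Term} {es : List Expr}
      {As : List Ty} :
      Translates Γ t e A → TranslatesList Γ ts es As →
      TranslatesList Γ (t :: ts) (e :: es) (A :: As)

/-- The translation of a sequence of field definitions, pointwise. -/
inductive TranslatesFields :
    Env Ty → List (Label × Term) → List (Label × Expr) → List (Label × Ty) → Prop where
  | nil {Γ : Env Ty} : TranslatesFields Γ [] [] []
  | cons {Γ : Env Ty} {l : Label} {t : Term} {e : Expr} {A : Ty} {fs : List (Label × Term)}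
      {es : List (Label × Expr)} {As : List (Label × Ty)} :
      Translates Γ t e A → TranslatesFields Γ fs es As →
      TranslatesFields Γ ((l, t) :: fs) ((l, e) :: es) ((l, A) :: As)

/-- The translation of a sequence of method definitions, pointwise. -/
inductive TranslatesMethods :
    Env Ty → Ty → List (Label × Method) → List (Label × Expr) → List (Label × Ty) → Prop where
  | nil {Γ : Env Ty} {Ac : Ty} : TranslatesMethods Γ Ac [] [] []
  | cons {Γ : Env Ty} {Ac : Ty} {l : Label} {m : Method} {e : Expr} {A : Ty}
      {ms : List (Label × Method)} {es : List (Label × Expr)} {As : List (Label × Ty)} :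
      TranslatesMethod Γ Ac m e A → TranslatesMethods Γ Ac ms es As →
      TranslatesMethods Γ Ac ((l, m) :: ms) ((l, e) :: es) ((l, A) :: As)

/-- `Γ ⊢_σ c ⇝ e : Ā`. -/
inductive TranslatesCtor : Env Ty → Ctor → Expr → List Ty → Prop where
  | mk {Γ : Env Ty} {xs : Var} {ps : List (Var × Ty)} {t : Term} {e : Expr} {A : Ty} :
      Translates ((Γ.bind xs .dyn).extend ps) t e A →
      TranslatesCtor Γ (.mk xs ps t) (.fn (xs :: ps.map Prod.fst) (checkParams ps e))
        (ps.map Prod.snd)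

/-- `Γ; A ⊢_ς m ⇝ e : A'`. -/
inductive TranslatesMethod : Env Ty → Ty → Method → Expr → Ty → Prop where
  | mk {Γ : Env Ty} {q : Openness} {Δ₁ Δ₂ : Attrs} {Acs : List Ty} {xs : Var}
      {ps : List (Var × Ty)} {Ao A₂ A₂' : Ty} {t : Term} {e : Expr} :
      Ao = .obj q (Δ₁.instantiate Δ₂) → SubConsistent A₂' A₂ →
      Translates ((Γ.bind xs Ao).extend ps) t e A₂' →
      TranslatesMethod Γ (.cls q Δ₁ Δ₂ Acs) (.mk xs ps A₂ t)
        (.fn (xs :: ps.map Prod.fst)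
          (.letIn xs (.check (.var xs) Ao.tag) (checkParams ps e)))
        (.fn (ps.map Prod.snd) A₂)

end

/-! ### Heaps and attribute lookup -/

/-- Heap values: a class (superclasses, attributes, constructor), or an object (its class, its
own attributes). Attributes are association lists read through `List.lookup`. -/
inductive HeapVal where
  | cls (supers : List Addr) (M : List (Label × Value)) (ctor : Value)
  | obj (a : Addr) (M : List (Label × Value))

/-- Heaps `μ`: finite maps from addresses to heap values. -/
abbrev Heap := Finmap (fun _ : Addr => HeapVal)

/-- `GetAttr μ x a o`: the search for `x` from `a`, depth first and left to right through the
inheritance hierarchy, ends with outcome `o`. So `getattr(a,x,μ) = v` is `GetAttr μ x a (some v)`,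
and outcome `none` means that the search fails. -/
inductive GetAttr (μ : Heap) (x : Label) : Addr → Option Value → Prop where
  | dangling {a : Addr} : μ.lookup a = none → GetAttr μ x a none
  | objHere {a a' : Addr} {M : List (Label × Value)} {v : Value} :
      μ.lookup a = some (.obj a' M) → M.lookup x = some v → GetAttr μ x a (some v)
  | objUp {a a' : Addr} {M : List (Label × Value)} {o : Option Value} :
      μ.lookup a = some (.obj a' M) → M.lookup x = none → GetAttr μ x a' o → GetAttr μ x a o
  | clsHere {a : Addr} {as : List Addr} {M : List (Label × Value)} {c v : Value} :
      μ.lookup a = some (.cls as M c) → M.lookup x = some v → GetAttr μ x a (some v)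
  | clsUp {a a' : Addr} {as₁ as₂ : List Addr} {M : List (Label × Value)} {c v : Value} :
      μ.lookup a = some (.cls (as₁ ++ a' :: as₂) M c) → M.lookup x = none →
      (∀ b ∈ as₁, GetAttr μ x b none) → GetAttr μ x a' (some v) → GetAttr μ x a (some v)
  | clsNone {a : Addr} {as : List Addr} {M : List (Label × Value)} {c : Value} :
      μ.lookup a = some (.cls as M c) → M.lookup x = none →
      (∀ b ∈ as, GetAttr μ x b none) → GetAttr μ x a none

/-- `hasattrs(a,δ,μ)`. -/
def HasAttrs (μ : Heap) (a : Addr) (δ : Finset Label) : Prop :=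
  ∀ x ∈ δ, ∃ v, GetAttr μ x a (some v)

/-- `param-match(v,μ,C)`. -/
inductive ParamMatch (μ : Heap) : Expr → Arity → Prop where
  | fnAny {xs : List Var} {e : Expr} : ParamMatch μ (.fn xs e) .any
  | fnNum {xs : List Var} {e : Expr} {n : ℕ} : xs.length = n → ParamMatch μ (.fn xs e) (.num n)
  | clsAny {a : Addr} {as : List Addr} {M : List (Label × Value)} {v : Value} :
      μ.lookup a = some (.cls as M v) → ParamMatch μ (.addr a) .any
  | clsNum {a : Addr} {as : List Addr} {M : List (Label × Value)} {v : Value} {n : ℕ} :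
      μ.lookup a = some (.cls as M v) → ParamMatch μ v.1 (.num (n + 1)) →
      ParamMatch μ (.addr a) (.num n)

/-- `check(v,μ,S)`. The arity of a class tag, like that of a function tag, does not count the
receiver of the constructor: `ParamMatch μ (.addr a)` accounts for it. -/
inductive Check (μ : Heap) : Expr → Tag → Prop where
  | pyobj {v : Expr} : Check μ v .pyobj
  | int {n : ℤ} : Check μ (.num n) .int
  | obj {a : Addr} {δ : Finset Label} : HasAttrs μ a δ → Check μ (.addr a) (.obj δ)
  | fn {xs : List Var} {e : Expr} {n : ℕ} : xs.length = n → Check μ (.fn xs e) (.fn n)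
  | clsFn {a : Addr} {as : List Addr} {M : List (Label × Value)} {v : Value} {n : ℕ} :
      μ.lookup a = some (.cls as M v) → ParamMatch μ v.1 (.num (n + 1)) →
      Check μ (.addr a) (.fn n)
  | cls {a : Addr} {as : List Addr} {M : List (Label × Value)} {v : Value} {C : Arity}
      {δ : Finset Label} :
      μ.lookup a = some (.cls as M v) → ParamMatch μ (.addr a) C → HasAttrs μ a δ →
      Check μ (.addr a) (.cls δ C)

/-- Results `r` of evaluation. -/
inductive Result where
  | conf (e : Expr) (μ : Heap)
  | castError
  | pyError (p : Origin)

/-- `lookup(a,h,ℓ,μ,p) = r`. -/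
inductive Lookup (μ : Heap) (a : Addr) (l : Label) (p : Origin) : HeapVal → Result → Prop where
  | own {a' : Addr} {M : List (Label × Value)} {v : Value} :
      M.lookup l = some v → Lookup μ a l p (.obj a' M) (.conf v.1 μ)
  | field {a' : Addr} {M : List (Label × Value)} {v : Value} :
      M.lookup l = none → GetAttr μ l a (some v) → (∀ xs e, v.1 ≠ .fn xs e) →
      Lookup μ a l p (.obj a' M) (.conf v.1 μ)
  | method {a' : Addr} {M : List (Label × Value)} {v : Value} {xs ys : List Var} {e : Expr} :
      M.lookup l = none → GetAttr μ l a (some v) → v.1 = .fn xs e →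
      ys.length + 1 = xs.length → ys.Nodup →
      Lookup μ a l p (.obj a' M) (.conf (.fn ys (.app v.1 (.addr a :: ys.map .var) p)) μ)
  | nullary {a' : Addr} {M : List (Label × Value)} {v : Value} {e : Expr} :
      M.lookup l = none → GetAttr μ l a (some v) → v.1 = .fn [] e →
      Lookup μ a l p (.obj a' M) .castError
  | cls {as : List Addr} {M : List (Label × Value)} {c v : Value} :
      GetAttr μ l a (some v) → Lookup μ a l p (.cls as M c) (.conf v.1 μ)

/-! ### Evaluation -/

/-- Reduction of redexes, `e ∣ μ ⟶ r`. An attribute update `M[ℓ=v]` puts the new binding in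
front, where it shadows any old one. -/
inductive Red : Expr → Heap → Result → Prop where
  | check {v : Value} {S : Tag} {μ : Heap} :
      Check μ v.1 S → Red (.check v.1 S) μ (.conf v.1 μ)
  | checkFail {v : Value} {S : Tag} {μ : Heap} :
      ¬ Check μ v.1 S → Red (.check v.1 S) μ .castError
  | app {xs : List Var} {e : Expr} {vs : List Value} {p : Origin} {μ : Heap} :
      xs.length = vs.length →
      Red (.app (.fn xs e) (vs.map Subtype.val) p) μ (.conf (e.subst (.ofLists xs vs)) μ)
  | appCls {a a' : Addr} {as : List Addr} {M : List (Label × Value)} {c : Value}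
      {vs : List Value} {x : Var} {p : Origin} {μ : Heap} :
      μ.lookup a = some (.cls as M c) → a' ∉ μ →
      Red (.app (.addr a) (vs.map Subtype.val) p) μ
        (.conf (.letIn x (.app c.1 (.addr a' :: vs.map Subtype.val) p) (.addr a'))
          (μ.insert a' (.obj a [])))
  | appFail {v : Value} {vs : List Value} {p : Origin} {μ : Heap} :
      (¬ ∃ xs e, v.1 = .fn xs e ∧ xs.length = vs.length) →
      (¬ ∃ a as M c, v.1 = .addr a ∧ μ.lookup a = some (.cls as M c)) →
      Red (.app v.1 (vs.map Subtype.val) p) μ (.pyError p)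
  | letIn {x : Var} {v : Value} {e : Expr} {μ : Heap} :
      Red (.letIn x v.1 e) μ (.conf (e.subst (.ofLists [x] [v])) μ)
  | cls {as : List Addr} {M : List (Label × Value)} {v : Value} {a' : Addr} {p : Origin}
      {μ : Heap} :
      (∀ a ∈ as, ∃ as' M' v', μ.lookup a = some (.cls as' M' v')) →
      ParamMatch μ v.1 .any → a' ∉ μ →
      Red (.cls (as.map .addr) (valueMembers M) v.1 p) μ
        (.conf (.addr a') (μ.insert a' (.cls as M v)))
  | clsFail {vs : List Value} {M : List (Label × Value)} {v : Value} {p : Origin} {μ : Heap} :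
      ¬ ((∀ u ∈ vs, ∃ a as' M' v', u.1 = .addr a ∧ μ.lookup a = some (.cls as' M' v')) ∧
          ParamMatch μ v.1 .any) →
      Red (.cls (vs.map Subtype.val) (valueMembers M) v.1 p) μ (.pyError p)
  | get {a : Addr} {l : Label} {p : Origin} {μ : Heap} {h : HeapVal} {r : Result} :
      μ.lookup a = some h → Lookup μ a l p h r → Red (.get (.addr a) l p) μ r
  | getFail {v : Value} {l : Label} {p : Origin} {μ : Heap} :
      (¬ ∃ a h r, v.1 = .addr a ∧ μ.lookup a = some h ∧ Lookup μ a l p h r) →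
      Red (.get v.1 l p) μ (.pyError p)
  | setObj {a a' : Addr} {l : Label} {p : Origin} {v : Value} {M : List (Label × Value)}
      {μ : Heap} :
      μ.lookup a = some (.obj a' M) →
      Red (.set (.addr a) l p v.1) μ (.conf (.num 0) (μ.insert a (.obj a' ((l, v) :: M))))
  | setCls {a : Addr} {as : List Addr} {l : Label} {p : Origin} {v c : Value}
      {M : List (Label × Value)} {μ : Heap} :
      μ.lookup a = some (.cls as M c) →
      Red (.set (.addr a) l p v.1) μ (.conf (.num 0) (μ.insert a (.cls as ((l, v) :: M) c)))
  | setFail {u v : Value} {l : Label} {p : Origin} {μ : Heap} :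
      (¬ ∃ a h, u.1 = .addr a ∧ μ.lookup a = some h) →
      Red (.set u.1 l p v.1) μ (.pyError p)

/-- Evaluation contexts `E`. -/
inductive ECtx where
  | hole
  | appFn (E : ECtx) (es : List Expr) (p : Origin)
  | appArg (v : Value) (vs : List Value) (E : ECtx) (es : List Expr) (p : Origin)
  | get (E : ECtx) (l : Label) (p : Origin)
  | setL (E : ECtx) (l : Label) (p : Origin) (e : Expr)
  | setR (v : Value) (l : Label) (p : Origin) (E : ECtx)
  | letIn (x : Var) (E : ECtx) (e : Expr)
  | check (E : ECtx) (S : Tag)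
  | clsSuper (vs : List Value) (E : ECtx) (es : List Expr) (ms : List (Label × Expr))
      (c : Expr) (p : Origin)
  | clsCtor (vs : List Value) (ms : List (Label × Expr)) (E : ECtx) (p : Origin)
  | clsMember (vs : List Value) (M : List (Label × Value)) (l : Label) (E : ECtx)
      (ms : List (Label × Expr)) (v : Value) (p : Origin)

/-- `E[e]`. -/
def ECtx.plug (e₀ : Expr) : ECtx → Expr
  | .hole => e₀
  | .appFn E es p => .app (E.plug e₀) es p
  | .appArg v vs E es p => .app v.1 (vs.map Subtype.val ++ E.plug e₀ :: es) p
  | .get E l p => .get (E.plug e₀) l p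
  | .setL E l p e => .set (E.plug e₀) l p e
  | .setR v l p E => .set v.1 l p (E.plug e₀)
  | .letIn x E e => .letIn x (E.plug e₀) e
  | .check E S => .check (E.plug e₀) S
  | .clsSuper vs E es ms c p => .cls (vs.map Subtype.val ++ E.plug e₀ :: es) ms c p
  | .clsCtor vs ms E p => .cls (vs.map Subtype.val) ms (E.plug e₀) p
  | .clsMember vs M l E ms v p =>
      .cls (vs.map Subtype.val) (valueMembers M ++ (l, E.plug e₀) :: ms) v.1 p

/-- Single steps under evaluation contexts, `e ∣ μ ⟼ r`. -/
inductive Step : Expr → Heap → Result → Prop where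
  | step (E : ECtx) {e e' : Expr} {μ μ' : Heap} :
      Red e μ (.conf e' μ') → Step (E.plug e) μ (.conf (E.plug e') μ')
  | pyError (E : ECtx) {e : Expr} {μ : Heap} {p : Origin} :
      Red e μ (.pyError p) → Step (E.plug e) μ (.pyError p)
  | castError (E : ECtx) {e : Expr} {μ : Heap} :
      Red e μ .castError → Step (E.plug e) μ .castError

/-- Many steps, `e ∣ μ ⟶* r`. -/
inductive Steps : Expr → Heap → Result → Prop where
  | refl {e : Expr} {μ : Heap} : Steps e μ (.conf e μ)
  | pyError {e : Expr} {μ : Heap} {p : Origin} : Step e μ (.pyError p) → Steps e μ (.pyError p)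
  | castError {e : Expr} {μ : Heap} : Step e μ .castError → Steps e μ .castError
  | chain {e e' : Expr} {μ μ' : Heap} {r : Result} :
      Step e μ (.conf e' μ') → Steps e' μ' r → Steps e μ r

/-! ### The tag system of μPython -/

/-- Subtyping `S <: S'` of tags. -/
inductive Sub : Tag → Tag → Prop where
  | top (S : Tag) : Sub S .pyobj
  | int : Sub .int .int
  | trans {S₁ S₂ S₃ : Tag} : Sub S₁ S₂ → Sub S₂ S₃ → Sub S₁ S₃
  | obj {δ₁ δ₂ : Finset Label} : δ₂ ⊆ δ₁ → Sub (.obj δ₁) (.obj δ₂)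
  | clsAny {δ : Finset Label} {n : ℕ} : Sub (.cls δ (.num n)) (.cls δ .any)
  | cls {δ₁ δ₂ : Finset Label} {C : Arity} : δ₂ ⊆ δ₁ → Sub (.cls δ₁ C) (.cls δ₂ C)
  | clsObj {δ : Finset Label} {C : Arity} : Sub (.cls δ C) (.obj δ)
  | clsFn {δ : Finset Label} {n : ℕ} : Sub (.cls δ (.num n)) (.fn n)

/-- Heap types `Σ`: finite maps from addresses to tags. -/
abbrev HeapTy := Finmap (fun _ : Addr => Tag)

/-- The labels of a list of class members. -/
def memberLabels (ms : List (Label × Expr)) : Finset Label := (ms.map Prod.fst).toFinset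

/-- `Γ; Σ ⊢ e : S`. -/
inductive HasType (H : HeapTy) : Env Tag → Expr → Tag → Prop where
  | sub {Γ : Env Tag} {e : Expr} {S₁ S₂ : Tag} :
      HasType H Γ e S₂ → Sub S₂ S₁ → HasType H Γ e S₁
  | var {Γ : Env Tag} {x : Var} {S : Tag} : Γ x = some S → HasType H Γ (.var x) S
  | addr {Γ : Env Tag} {a : Addr} {S : Tag} : H.lookup a = some S → HasType H Γ (.addr a) S
  | num {Γ : Env Tag} {n : ℤ} : HasType H Γ (.num n) .int
  | appDyn {Γ : Env Tag} {e : Expr} {es : List Expr} :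
      HasType H Γ e .pyobj → (∀ e' ∈ es, HasType H Γ e' .pyobj) →
      HasType H Γ (.app e es .untyped) .pyobj
  | app {Γ : Env Tag} {e : Expr} {es : List Expr} {n : ℕ} :
      HasType H Γ e (.fn n) → (∀ e' ∈ es, HasType H Γ e' .pyobj) → es.length = n →
      HasType H Γ (.app e es .typed) .pyobj
  | getDyn {Γ : Env Tag} {e : Expr} {l : Label} :
      HasType H Γ e .pyobj → HasType H Γ (.get e l .untyped) .pyobj
  | get {Γ : Env Tag} {e : Expr} {l : Label} :
      HasType H Γ e (.obj {l}) → HasType H Γ (.get e l .typed) .pyobj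
  | setDyn {Γ : Env Tag} {e₁ e₂ : Expr} {l : Label} :
      HasType H Γ e₁ .pyobj → HasType H Γ e₂ .pyobj →
      HasType H Γ (.set e₁ l .untyped e₂) .int
  | set {Γ : Env Tag} {e₁ e₂ : Expr} {l : Label} :
      HasType H Γ e₁ (.obj ∅) → HasType H Γ e₂ .pyobj →
      HasType H Γ (.set e₁ l .typed e₂) .int
  | clsDyn {Γ : Env Tag} {ss : List Expr} {ms : List (Label × Expr)} {c : Expr} :
      (∀ s ∈ ss, HasType H Γ s .pyobj) → (∀ m ∈ ms, HasType H Γ m.2 .pyobj) →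
      HasType H Γ c .pyobj →
      HasType H Γ (.cls ss ms c .untyped) (.cls (memberLabels ms) .any)
  | cls {Γ : Env Tag} {ss : List Expr} {δs : List (Finset Label)} {ms : List (Label × Expr)}
      {c : Expr} {n : ℕ} :
      ss.length = δs.length →
      (∀ (i : ℕ) (h : i < ss.length) (h' : i < δs.length),
        HasType H Γ ss[i] (.cls δs[i] .any)) →
      (∀ m ∈ ms, HasType H Γ m.2 .pyobj) → HasType H Γ c (.fn (n + 1)) →
      HasType H Γ (.cls ss ms c .typed)
        (.cls (memberLabels ms ∪ δs.foldr (· ∪ ·) ∅) (.num n))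
  | fn {Γ : Env Tag} {xs : List Var} {e : Expr} :
      HasType H (Γ.extend (xs.map (fun x => (x, Tag.pyobj)))) e .pyobj →
      HasType H Γ (.fn xs e) (.fn xs.length)
  | check {Γ : Env Tag} {e : Expr} {S : Tag} :
      HasType H Γ e .pyobj → HasType H Γ (.check e S) S
  | letIn {Γ : Env Tag} {x : Var} {e₁ e₂ : Expr} {S₁ S₂ : Tag} :
      HasType H Γ e₁ S₁ → HasType H (Γ.bind x S₁) e₂ S₂ →
      HasType H Γ (.letIn x e₁ e₂) S₂

/-- `Σ; μ ⊢ a : S`. -/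
inductive AddrOk (H : HeapTy) (μ : Heap) : Addr → Tag → Prop where
  | cls {a : Addr} {as : List Addr} {M : List (Label × Value)} {v : Value} {δ : Finset Label}
      {C : Arity} :
      μ.lookup a = some (.cls as M v) → HasAttrs μ a δ → ParamMatch μ (.addr a) C →
      (∀ a' ∈ as, ∃ δ' C', H.lookup a' = some (.cls δ' C')) →
      (∀ m ∈ M, HasType H .empty m.2.1 .pyobj) → HasType H .empty v.1 .pyobj →
      AddrOk H μ a (.cls δ C)
  | obj {a a' : Addr} {M : List (Label × Value)} {δ : Finset Label} :
      μ.lookup a = some (.obj a' M) → HasAttrs μ a δ →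
      (∃ δ' C', H.lookup a' = some (.cls δ' C')) →
      (∀ m ∈ M, HasType H .empty m.2.1 .pyobj) →
      AddrOk H μ a (.obj δ)

/-- `Σ ⊢ μ`. -/
def HeapOk (H : HeapTy) (μ : Heap) : Prop :=
  (∀ a, a ∈ H ↔ a ∈ μ) ∧ ∀ a S, H.lookup a = some S → AddrOk H μ a S

/-! ### Untyped code contexts -/

/-- Code contexts `𝒞`, whose own nodes carry the label `•`. -/
inductive Ctx where
  | hole
  | appFn (C : Ctx) (es : List Expr)
  | appArg (e : Expr) (es₁ : List Expr) (C : Ctx) (es₂ : List Expr)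
  | get (C : Ctx) (l : Label)
  | setL (C : Ctx) (l : Label) (e : Expr)
  | setR (e : Expr) (l : Label) (C : Ctx)
  | clsSuper (ss₁ : List Expr) (C : Ctx) (ss₂ : List Expr) (ms : List (Label × Expr)) (c : Expr)
  | clsMember (ss : List Expr) (ms₁ : List (Label × Expr)) (l : Label) (C : Ctx)
      (ms₂ : List (Label × Expr)) (c : Expr)
  | clsCtor (ss : List Expr) (ms : List (Label × Expr)) (C : Ctx)
  | letL (x : Var) (C : Ctx) (e : Expr)
  | letR (x : Var) (e : Expr) (C : Ctx)
  | check (C : Ctx) (S : Tag)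
  | fn (xs : List Var) (C : Ctx)

/-- `𝒞[e]`; binders of the context capture free variables of `e`. -/
def Ctx.plug (e₀ : Expr) : Ctx → Expr
  | .hole => e₀
  | .appFn C es => .app (C.plug e₀) es .untyped
  | .appArg e es₁ C es₂ => .app e (es₁ ++ C.plug e₀ :: es₂) .untyped
  | .get C l => .get (C.plug e₀) l .untyped
  | .setL C l e => .set (C.plug e₀) l .untyped e
  | .setR e l C => .set e l .untyped (C.plug e₀)
  | .clsSuper ss₁ C ss₂ ms c => .cls (ss₁ ++ C.plug e₀ :: ss₂) ms c .untyped
  | .clsMember ss ms₁ l C ms₂ c => .cls ss (ms₁ ++ (l, C.plug e₀) :: ms₂) c .untyped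
  | .clsCtor ss ms C => .cls ss ms (C.plug e₀) .untyped
  | .letL x C e => .letIn x (C.plug e₀) e
  | .letR x e C => .letIn x e (C.plug e₀)
  | .check C S => .check (C.plug e₀) S
  | .fn xs C => .fn xs (C.plug e₀)

/-- `CtxType Γ S 𝒞 Γ' S'` is `𝒞 : Γ; S ⇒ Γ'; S'`. -/
inductive CtxType (Γ : Env Tag) (S : Tag) : Ctx → Env Tag → Tag → Prop where
  | hole : CtxType Γ S .hole Γ S
  | sub {C : Ctx} {Γ' : Env Tag} {S₂ S₃ : Tag} :
      CtxType Γ S C Γ' S₃ → Sub S₃ S₂ → CtxType Γ S C Γ' S₂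
  | appFn {C : Ctx} {Γ' : Env Tag} {es : List Expr} :
      CtxType Γ S C Γ' .pyobj → (∀ e ∈ es, HasType ∅ Γ' e .pyobj) →
      CtxType Γ S (.appFn C es) Γ' .pyobj
  | appArg {C : Ctx} {Γ' : Env Tag} {e : Expr} {es₁ es₂ : List Expr} :
      HasType ∅ Γ' e .pyobj → (∀ e' ∈ es₁, HasType ∅ Γ' e' .pyobj) →
      (∀ e' ∈ es₂, HasType ∅ Γ' e' .pyobj) → CtxType Γ S C Γ' .pyobj →
      CtxType Γ S (.appArg e es₁ C es₂) Γ' .pyobj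
  | get {C : Ctx} {Γ' : Env Tag} {l : Label} :
      CtxType Γ S C Γ' .pyobj → CtxType Γ S (.get C l) Γ' .pyobj
  | setL {C : Ctx} {Γ' : Env Tag} {l : Label} {e : Expr} :
      CtxType Γ S C Γ' .pyobj → HasType ∅ Γ' e .pyobj → CtxType Γ S (.setL C l e) Γ' .int
  | setR {C : Ctx} {Γ' : Env Tag} {l : Label} {e : Expr} :
      HasType ∅ Γ' e .pyobj → CtxType Γ S C Γ' .pyobj → CtxType Γ S (.setR e l C) Γ' .int
  | clsSuper {C : Ctx} {Γ' : Env Tag} {ss₁ ss₂ : List Expr} {ms : List (Label × Expr)}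
      {c : Expr} :
      (∀ s ∈ ss₁, HasType ∅ Γ' s .pyobj) → (∀ s ∈ ss₂, HasType ∅ Γ' s .pyobj) →
      (∀ m ∈ ms, HasType ∅ Γ' m.2 .pyobj) → HasType ∅ Γ' c .pyobj →
      CtxType Γ S C Γ' .pyobj → CtxType Γ S (.clsSuper ss₁ C ss₂ ms c) Γ' .pyobj
  | clsMember {C : Ctx} {Γ' : Env Tag} {ss : List Expr} {ms₁ ms₂ : List (Label × Expr)}
      {l : Label} {c : Expr} :
      (∀ s ∈ ss, HasType ∅ Γ' s .pyobj) → (∀ m ∈ ms₁, HasType ∅ Γ' m.2 .pyobj) →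
      (∀ m ∈ ms₂, HasType ∅ Γ' m.2 .pyobj) → HasType ∅ Γ' c .pyobj →
      CtxType Γ S C Γ' .pyobj → CtxType Γ S (.clsMember ss ms₁ l C ms₂ c) Γ' .pyobj
  | clsCtor {C : Ctx} {Γ' : Env Tag} {ss : List Expr} {ms : List (Label × Expr)} :
      (∀ s ∈ ss, HasType ∅ Γ' s .pyobj) → (∀ m ∈ ms, HasType ∅ Γ' m.2 .pyobj) →
      CtxType Γ S C Γ' .pyobj → CtxType Γ S (.clsCtor ss ms C) Γ' .pyobj
  | fn {C : Ctx} {Γ' : Env Tag} {xs : List Var} :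
      CtxType Γ S C (Γ'.extend (xs.map (fun x => (x, Tag.pyobj)))) .pyobj →
      CtxType Γ S (.fn xs C) Γ' (.fn xs.length)
  | check {C : Ctx} {Γ' : Env Tag} {S' : Tag} :
      CtxType Γ S C Γ' .pyobj → CtxType Γ S (.check C S') Γ' S'
  | letL {C : Ctx} {Γ' : Env Tag} {x : Var} {e : Expr} {S₂ S₃ : Tag} :
      CtxType Γ S C Γ' S₂ → HasType ∅ (Γ'.bind x S₂) e S₃ →
      CtxType Γ S (.letL x C e) Γ' S₃
  | letR {C : Ctx} {Γ' : Env Tag} {x : Var} {e : Expr} {S₂ S₃ : Tag} :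
      HasType ∅ Γ' e S₂ → CtxType Γ S C (Γ'.bind x S₂) S₃ →
      CtxType Γ S (.letR x e C) Γ' S₃

end Anthill

namespace Anthill

/-! ### Tags -/

/-- The reflexive closure of `Sub`, by cases on the two tags. -/
def Tag.Le : Tag → Tag → Prop
  | _, .pyobj => True
  | .int, .int => True
  | .fn m, .fn n => m = n
  | .cls δ C, .cls δ' C' => δ' ⊆ δ ∧ (C' = C ∨ C' = .any)
  | .cls _ C, .fn n => C = .num n
  | .cls δ _, .obj δ' => δ' ⊆ δ
  | .obj δ, .obj δ' => δ' ⊆ δ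
  | _, _ => False

theorem Tag.Le.refl (S : Tag) : S.Le S := by
  cases S <;> simp [Tag.Le]

theorem Tag.Le.top (S : Tag) : S.Le .pyobj := by
  cases S <;> simp [Tag.Le]

theorem Tag.Le.trans {S₁ S₂ S₃ : Tag} (h : S₁.Le S₂) (h' : S₂.Le S₃) : S₁.Le S₃ := by
  cases S₁ <;> cases S₂ <;> cases S₃ <;> simp only [Tag.Le] at * <;> grind

theorem Sub.le {S₁ S₂ : Tag} (h : Sub S₁ S₂) : S₁.Le S₂ := by
  induction h with
  | top S => exact .top S
  | trans _ _ ih ih' => exact ih.trans ih'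
  | _ => simp_all [Tag.Le]

theorem Tag.Le.eq_or_sub {S₁ S₂ : Tag} (h : S₁.Le S₂) : S₁ = S₂ ∨ Sub S₁ S₂ := by
  cases S₁ <;> cases S₂ <;> simp only [Tag.Le] at h <;> try first
    | exact .inr (.top _)
    | exact .inl rfl
    | exact .inl (congrArg _ h)
    | exact .inr (.obj h)
    | exact .inr (.trans .clsObj (.obj h))
    | (subst h; exact .inr .clsFn)
  obtain ⟨h, rfl | rfl⟩ := h
  · exact .inr (.cls h)
  · rename_i C _
    cases C with
    | num n => exact .inr (.trans .clsAny (.cls h))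
    | any => exact .inr (.cls h)

theorem Tag.Le.to_cls {S : Tag} {δ : Finset Label} {C : Arity} (h : S.Le (.cls δ C)) :
    ∃ δ' C', S = .cls δ' C' ∧ δ ⊆ δ' ∧ (C = C' ∨ C = .any) := by
  cases S <;> simp_all [Tag.Le]

theorem HasType.of_le {H : HeapTy} {Γ : Env Tag} {e : Expr} {S S' : Tag}
    (h : HasType H Γ e S) (hle : S.Le S') : HasType H Γ e S' := by
  rcases hle.eq_or_sub with rfl | hs
  · exact h
  · exact h.sub hs

theorem HasType.pyobj {H : HeapTy} {Γ : Env Tag} {e : Expr} {S : Tag}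
    (h : HasType H Γ e S) : HasType H Γ e .pyobj :=
  h.sub (.top S)

/-! ### Environments -/

namespace Env

variable {α : Type}

theorem bind_mono {Γ Γ' : Env α} (h : ∀ x A, Γ x = some A → Γ' x = some A) (y : Var) (B : α) :
    ∀ x A, Γ.bind y B x = some A → Γ'.bind y B x = some A := by
  intro x A
  simp only [bind]
  split
  · exact id
  · exact h x A

theorem extend_mono {Γ Γ' : Env α} (h : ∀ x A, Γ x = some A → Γ' x = some A)
    (ps : List (Var × α)) :
    ∀ x A, Γ.extend ps x = some A → Γ'.extend ps x = some A := by
  induction ps generalizing Γ Γ' with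
  | nil => exact h
  | cons p ps ih => exact ih (bind_mono h p.1 p.2)

theorem bind_map {β : Type} (f : α → β) (Γ : Env α) (y : Var) (A : α) :
    (fun x => (Γ.bind y A x).map f) = bind (fun x => (Γ x).map f) y (f A) := by
  funext x
  simp only [bind]
  split <;> rfl

theorem extend_map {β : Type} (f : α → β) (Γ : Env α) (ps : List (Var × α)) :
    (fun x => (Γ.extend ps x).map f) =
      extend (fun x => (Γ x).map f) (ps.map fun p => (p.1, f p.2)) := by
  induction ps generalizing Γ with
  | nil => rfl
  | cons p ps ih => simp only [extend, List.map_cons, ih, bind_map]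

end Env

/-! ### Typing without subsumption at the root -/

theorem forall₂_iff_getElem {α β : Type} {R : α → β → Prop} {l : List α} {l' : List β} :
    List.Forall₂ R l l' ↔ l.length = l'.length ∧
      ∀ (i : ℕ) (h : i < l.length) (h' : i < l'.length), R l[i] l'[i] := by
  rw [List.forall₂_iff_get]
  simp only [List.get_eq_getElem]

/-- Tag typing whose last rule is not subsumption. -/
inductive DirectType (H : HeapTy) (Γ : Env Tag) : Expr → Tag → Prop where
  | var {x : Var} {S : Tag} : Γ x = some S → DirectType H Γ (.var x) S
  | addr {a : Addr} {S : Tag} : H.lookup a = some S → DirectType H Γ (.addr a) S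
  | num {n : ℤ} : DirectType H Γ (.num n) .int
  | appDyn {e : Expr} {es : List Expr} :
      HasType H Γ e .pyobj → (∀ e' ∈ es, HasType H Γ e' .pyobj) →
      DirectType H Γ (.app e es .untyped) .pyobj
  | app {e : Expr} {es : List Expr} :
      HasType H Γ e (.fn es.length) → (∀ e' ∈ es, HasType H Γ e' .pyobj) →
      DirectType H Γ (.app e es .typed) .pyobj
  | getDyn {e : Expr} {l : Label} :
      HasType H Γ e .pyobj → DirectType H Γ (.get e l .untyped) .pyobj
  | get {e : Expr} {l : Label} :
      HasType H Γ e (.obj {l}) → DirectType H Γ (.get e l .typed) .pyobj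
  | setDyn {e₁ e₂ : Expr} {l : Label} :
      HasType H Γ e₁ .pyobj → HasType H Γ e₂ .pyobj →
      DirectType H Γ (.set e₁ l .untyped e₂) .int
  | set {e₁ e₂ : Expr} {l : Label} :
      HasType H Γ e₁ (.obj ∅) → HasType H Γ e₂ .pyobj →
      DirectType H Γ (.set e₁ l .typed e₂) .int
  | clsDyn {ss : List Expr} {ms : List (Label × Expr)} {c : Expr} :
      (∀ s ∈ ss, HasType H Γ s .pyobj) → (∀ m ∈ ms, HasType H Γ m.2 .pyobj) →
      HasType H Γ c .pyobj →
      DirectType H Γ (.cls ss ms c .untyped) (.cls (memberLabels ms) .any)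
  | cls {ss : List Expr} {δs : List (Finset Label)} {ms : List (Label × Expr)}
      {c : Expr} {n : ℕ} :
      List.Forall₂ (fun s δ => HasType H Γ s (.cls δ .any)) ss δs →
      (∀ m ∈ ms, HasType H Γ m.2 .pyobj) → HasType H Γ c (.fn (n + 1)) →
      DirectType H Γ (.cls ss ms c .typed)
        (.cls (memberLabels ms ∪ δs.foldr (· ∪ ·) ∅) (.num n))
  | fn {xs : List Var} {e : Expr} :
      HasType H (Γ.extend (xs.map (fun x => (x, Tag.pyobj)))) e .pyobj →
      DirectType H Γ (.fn xs e) (.fn xs.length)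
  | check {e : Expr} {S : Tag} :
      HasType H Γ e .pyobj → DirectType H Γ (.check e S) S
  | letIn {x : Var} {e₁ e₂ : Expr} {S₁ S₂ : Tag} :
      HasType H Γ e₁ S₁ → HasType H (Γ.bind x S₁) e₂ S₂ →
      DirectType H Γ (.letIn x e₁ e₂) S₂

theorem HasType.exists_direct {H : HeapTy} {Γ : Env Tag} {e : Expr} {S : Tag}
    (h : HasType H Γ e S) : ∃ S₀, DirectType H Γ e S₀ ∧ S₀.Le S := by
  induction h with
  | sub _ hs ih =>
    obtain ⟨S₀, h, hle⟩ := ih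
    exact ⟨S₀, h, hle.trans hs.le⟩
  | var h => exact ⟨_, .var h, .refl _⟩
  | addr h => exact ⟨_, .addr h, .refl _⟩
  | num => exact ⟨_, .num, .refl _⟩
  | appDyn h h' => exact ⟨_, .appDyn h h', .refl _⟩
  | app h h' hn => subst hn; exact ⟨_, .app h h', .refl _⟩
  | getDyn h => exact ⟨_, .getDyn h, .refl _⟩
  | get h => exact ⟨_, .get h, .refl _⟩
  | setDyn h h' => exact ⟨_, .setDyn h h', .refl _⟩
  | set h h' => exact ⟨_, .set h h', .refl _⟩
  | clsDyn h h' hc => exact ⟨_, .clsDyn h h' hc, .refl _⟩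
  | cls hl h h' hc => exact ⟨_, .cls (forall₂_iff_getElem.2 ⟨hl, h⟩) h' hc, .refl _⟩
  | fn h => exact ⟨_, .fn h, .refl _⟩
  | check h => exact ⟨_, .check h, .refl _⟩
  | letIn h h' => exact ⟨_, .letIn h h', .refl _⟩

theorem DirectType.hasType {H : HeapTy} {Γ : Env Tag} {e : Expr} {S : Tag}
    (h : DirectType H Γ e S) : HasType H Γ e S := by
  cases h with
  | var h => exact .var h
  | addr h => exact .addr h
  | num => exact .num
  | appDyn h h' => exact .appDyn h h'
  | app h h' => exact .app h h' rfl
  | getDyn h => exact .getDyn h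
  | get h => exact .get h
  | setDyn h h' => exact .setDyn h h'
  | set h h' => exact .set h h'
  | clsDyn h h' hc => exact .clsDyn h h' hc
  | cls h h' hc => exact .cls (forall₂_iff_getElem.1 h).1 (forall₂_iff_getElem.1 h).2 h' hc
  | fn h => exact .fn h
  | check h => exact .check h
  | letIn h h' => exact .letIn h h'

/-! ### Refinement of heap types and weakening -/

/-- `H'` has at least the addresses of `H`, with smaller or equal tags. -/
def HeapTy.Refines (H H' : HeapTy) : Prop :=
  ∀ a S, H.lookup a = some S → ∃ S', H'.lookup a = some S' ∧ S'.Le S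

theorem HeapTy.Refines.refl (H : HeapTy) : H.Refines H :=
  fun _ S h => ⟨S, h, .refl S⟩

theorem HeapTy.Refines.trans {H₁ H₂ H₃ : HeapTy} (h : H₁.Refines H₂) (h' : H₂.Refines H₃) :
    H₁.Refines H₃ := by
  intro a S hS
  obtain ⟨S₂, hS₂, hle⟩ := h a S hS
  obtain ⟨S₃, hS₃, hle'⟩ := h' a S₂ hS₂
  exact ⟨S₃, hS₃, hle'.trans hle⟩

theorem HeapTy.Refines.exists_cls {H H' : HeapTy} (h : H.Refines H') {a : Addr}
    (ha : ∃ δ C, H.lookup a = some (.cls δ C)) : ∃ δ C, H'.lookup a = some (.cls δ C) := by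
  obtain ⟨δ, C, ha⟩ := ha
  obtain ⟨S, hS, hle⟩ := h a _ ha
  obtain ⟨δ', C', rfl, -⟩ := hle.to_cls
  exact ⟨δ', C', hS⟩

theorem HeapTy.Refines.insert {H : HeapTy} {a : Addr} {S : Tag}
    (h : ∀ S₀, H.lookup a = some S₀ → S.Le S₀) : H.Refines (H.insert a S) := by
  intro b S₀ hb
  by_cases hab : b = a
  · subst hab
    exact ⟨S, Finmap.lookup_insert _, h S₀ hb⟩
  · exact ⟨S₀, by rw [Finmap.lookup_insert_of_ne _ hab, hb], .refl _⟩

theorem HasType.mono {H H' : HeapTy} {Γ Γ' : Env Tag} {e : Expr} {S : Tag}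
    (h : HasType H Γ e S) (hH : H.Refines H') (hΓ : ∀ x S, Γ x = some S → Γ' x = some S) :
    HasType H' Γ' e S := by
  induction h generalizing Γ' with
  | sub _ hs ih => exact .sub (ih hΓ) hs
  | var h => exact .var (hΓ _ _ h)
  | addr h =>
    obtain ⟨S', hS', hle⟩ := hH _ _ h
    exact (HasType.addr hS').of_le hle
  | num => exact .num
  | appDyn _ _ ih ih' => exact .appDyn (ih hΓ) fun e he => ih' e he hΓ
  | app _ _ hn ih ih' => exact .app (ih hΓ) (fun e he => ih' e he hΓ) hn
  | getDyn _ ih => exact .getDyn (ih hΓ)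
  | get _ ih => exact .get (ih hΓ)
  | setDyn _ _ ih ih' => exact .setDyn (ih hΓ) (ih' hΓ)
  | set _ _ ih ih' => exact .set (ih hΓ) (ih' hΓ)
  | clsDyn _ _ _ ih ih' ihc =>
    exact .clsDyn (fun s hs => ih s hs hΓ) (fun m hm => ih' m hm hΓ) (ihc hΓ)
  | cls hl _ _ _ ih ih' ihc =>
    exact .cls hl (fun i h h' => ih i h h' hΓ) (fun m hm => ih' m hm hΓ) (ihc hΓ)
  | fn _ ih => exact .fn (ih (Env.extend_mono hΓ _))
  | check _ ih => exact .check (ih hΓ)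
  | letIn _ _ ih ih' => exact .letIn (ih hΓ) (ih' (Env.bind_mono hΓ _ _))

theorem HasType.refine {H H' : HeapTy} {Γ : Env Tag} {e : Expr} {S : Tag}
    (h : HasType H Γ e S) (hH : H.Refines H') : HasType H' Γ e S :=
  h.mono hH fun _ _ => id

theorem HasType.of_empty {H : HeapTy} (Γ : Env Tag) {e : Expr} {S : Tag}
    (h : HasType H .empty e S) : HasType H Γ e S :=
  h.mono (.refl H) fun _ _ hx => nomatch hx

/-! ### Substitution -/

theorem Expr.substList_eq_map (σ : Subst) (es : List Expr) :
    Expr.substList σ es = es.map (Expr.subst σ) := by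
  induction es with
  | nil => rfl
  | cons e es ih => rw [Expr.substList, ih, List.map_cons]

theorem Expr.substMembers_eq_map (σ : Subst) (ms : List (Label × Expr)) :
    Expr.substMembers σ ms = ms.map fun m => (m.1, m.2.subst σ) := by
  induction ms with
  | nil => rfl
  | cons m ms ih => rw [Expr.substMembers, ih, List.map_cons]

/-- `σ` replaces variables of `Γ` by closed values of their tags and leaves `Γ'`. -/
def Subst.Typed (H : HeapTy) (σ : Subst) (Γ Γ' : Env Tag) : Prop :=
  ∀ x S, Γ x = some S →
    (∃ v, σ x = some v ∧ HasType H .empty v.1 S) ∨ (σ x = none ∧ Γ' x = some S)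

theorem Env.extend_eq_of_notMem {α : Type} {Γ : Env α} {ps : List (Var × α)} {x : Var}
    (h : x ∉ ps.map Prod.fst) : Γ.extend ps x = Γ x := by
  induction ps generalizing Γ with
  | nil => rfl
  | cons p ps ih =>
    simp only [List.map_cons, List.mem_cons, not_or] at h
    rw [Env.extend, ih h.2, Env.bind, if_neg h.1]

theorem Env.extend_eq_of_mem {α : Type} (Γ Γ' : Env α) {ps : List (Var × α)} {x : Var}
    (h : x ∈ ps.map Prod.fst) : Γ.extend ps x = Γ'.extend ps x := by
  induction ps generalizing Γ Γ' with
  | nil => simp at h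
  | cons p ps ih =>
    simp only [Env.extend]
    by_cases hx : x ∈ ps.map Prod.fst
    · exact ih _ _ hx
    · rw [extend_eq_of_notMem hx, extend_eq_of_notMem hx]
      simp only [List.map_cons, List.mem_cons, hx, or_false] at h
      simp [Env.bind, h]

theorem Subst.Typed.extend {H : HeapTy} {σ : Subst} {Γ Γ' : Env Tag} (h : σ.Typed H Γ Γ')
    (ps : List (Var × Tag)) :
    (σ.remove (ps.map Prod.fst)).Typed H (Γ.extend ps) (Γ'.extend ps) := by
  intro x S hx
  by_cases hm : x ∈ ps.map Prod.fst
  · exact .inr ⟨by simp only [Subst.remove, if_pos hm], by rwa [Env.extend_eq_of_mem Γ' Γ hm]⟩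
  · rw [Env.extend_eq_of_notMem hm] at hx ⊢
    simpa only [Subst.remove, if_neg hm] using h x S hx

theorem HasType.subst {H : HeapTy} {Γ Γ' : Env Tag} {σ : Subst} {e : Expr} {S : Tag}
    (h : HasType H Γ e S) (hσ : σ.Typed H Γ Γ') : HasType H Γ' (e.subst σ) S := by
  induction h generalizing Γ' σ with
  | sub _ hs ih => exact .sub (ih hσ) hs
  | var h =>
    rcases hσ _ _ h with ⟨v, hv, ht⟩ | ⟨hn, hx⟩
    · simpa only [Expr.subst, hv] using ht.of_empty Γ'
    · simpa only [Expr.subst, hn] using HasType.var hx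
  | addr h => exact .addr h
  | num => exact .num
  | appDyn _ _ ih ih' =>
    simp only [Expr.subst, Expr.substList_eq_map]
    exact .appDyn (ih hσ) (List.forall_mem_map.2 fun e he => ih' e he hσ)
  | app _ _ hn ih ih' =>
    simp only [Expr.subst, Expr.substList_eq_map]
    exact .app (ih hσ) (List.forall_mem_map.2 fun e he => ih' e he hσ) (by simpa using hn)
  | getDyn _ ih => exact .getDyn (ih hσ)
  | get _ ih => exact .get (ih hσ)
  | setDyn _ _ ih ih' => exact .setDyn (ih hσ) (ih' hσ)
  | set _ _ ih ih' => exact .set (ih hσ) (ih' hσ)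
  | @clsDyn _ _ ms _ _ _ _ ih ih' ihc =>
    have hl : memberLabels (ms.map fun m => (m.1, m.2.subst σ)) = memberLabels ms := by
      simp only [memberLabels, List.map_map]; rfl
    simp only [Expr.subst, Expr.substList_eq_map, Expr.substMembers_eq_map, ← hl]
    exact .clsDyn (List.forall_mem_map.2 fun s hs => ih s hs hσ)
      (List.forall_mem_map.2 fun m hm => ih' m hm hσ) (ihc hσ)
  | @cls _ _ _ ms _ _ hl _ _ _ ih ih' ihc =>
    have hms : memberLabels (ms.map fun m => (m.1, m.2.subst σ)) = memberLabels ms := by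
      simp only [memberLabels, List.map_map]; rfl
    simp only [Expr.subst, Expr.substList_eq_map, Expr.substMembers_eq_map, ← hms]
    refine .cls (by simpa using hl) (fun i h h' => ?_)
      (List.forall_mem_map.2 fun m hm => ih' m hm hσ) (ihc hσ)
    rw [List.getElem_map]
    exact ih i (by simpa using h) h' hσ
  | @fn _ xs _ _ ih =>
    refine .fn (ih ?_)
    have := hσ.extend (xs.map fun x => (x, Tag.pyobj))
    simpa [List.map_map, Function.comp_def] using this
  | check _ ih => exact .check (ih hσ)
  | letIn _ _ ih ih' => exact .letIn (ih hσ) (ih' (hσ.extend [(_, _)]))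

theorem HasType.subst_ofLists {H : HeapTy} {xs : List Var} {vs : List Value} {e : Expr} {S : Tag}
    {ts : List Tag} (hxs : xs.length = vs.length)
    (hvs : List.Forall₂ (fun v T => HasType H .empty v.1 T) vs ts)
    (h : HasType H (Env.empty.extend (xs.zip ts)) e S) :
    HasType H .empty (e.subst (.ofLists xs vs)) S := by
  refine h.subst ?_
  have key : ∀ (Γ : Env Tag) (σ : Env Value), Subst.Typed H σ Γ .empty →
      Subst.Typed H (σ.extend (xs.zip vs)) (Γ.extend (xs.zip ts)) .empty := by
    clear h
    induction hvs generalizing xs with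
    | nil => intro Γ σ h; simpa [Env.extend] using h
    | @cons v T vs ts hv _ ih =>
      intro Γ σ h
      cases xs with
      | nil => simp at hxs
      | cons x xs =>
        refine ih (by simpa using hxs) _ _ ?_
        intro y S hy
        simp only [Env.bind] at hy ⊢
        split at hy
        · simp only [Option.some.injEq] at hy
          subst hy
          simp_all
        · simpa [*] using h y S hy
  exact key _ _ fun x S hx => nomatch hx

/-! ### Attribute lookup -/

/-- The addresses that a heap value refers to for inherited attributes. -/
def HeapVal.parents : HeapVal → List Addr
  | .cls as _ _ => as
  | .obj a _ => [a]

/-- The attributes stored in a heap value. -/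
def HeapVal.attrs : HeapVal → List (Label × Value)
  | .cls _ M _ => M
  | .obj _ M => M

/-- Changing only attributes, and keeping at least those that were defined. -/
inductive HeapVal.Extends : HeapVal → HeapVal → Prop where
  | cls {as : List Addr} {M M' : List (Label × Value)} {c : Value} :
      (∀ x, M'.lookup x = none → M.lookup x = none) → Extends (.cls as M c) (.cls as M' c)
  | obj {a : Addr} {M M' : List (Label × Value)} :
      (∀ x, M'.lookup x = none → M.lookup x = none) → Extends (.obj a M) (.obj a M')

theorem HeapVal.Extends.refl (h : HeapVal) : h.Extends h := by
  cases h
  · exact .cls fun _ => id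
  · exact .obj fun _ => id

namespace Heap

/-- Every heap value of `μ` occurs in `μ'`, possibly with more attributes. -/
def Extends (μ μ' : Heap) : Prop :=
  ∀ a h, μ.lookup a = some h → ∃ h', μ'.lookup a = some h' ∧ h.Extends h'

/-- The parents of all heap values are allocated. -/
def Closed (μ : Heap) : Prop :=
  ∀ a h, μ.lookup a = some h → ∀ b ∈ h.parents, b ∈ μ

/-- The search for any attribute terminates. -/
def Total (μ : Heap) : Prop :=
  ∀ x, ∀ a ∈ μ, ∃ o, GetAttr μ x a o

theorem Extends.refl (μ : Heap) : μ.Extends μ :=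
  fun _ h ha => ⟨h, ha, .refl h⟩

theorem extends_insert_fresh {μ : Heap} {a : Addr} (ha : a ∉ μ) (hv : HeapVal) :
    μ.Extends (μ.insert a hv) := by
  intro b h hb
  have hne : b ≠ a := by
    rintro rfl
    exact ha (Finmap.mem_iff.2 ⟨h, hb⟩)
  exact ⟨h, by rw [Finmap.lookup_insert_of_ne _ hne, hb], .refl h⟩

theorem extends_insert {μ : Heap} {a : Addr} {hv hv' : HeapVal} (ha : μ.lookup a = some hv)
    (h : hv.Extends hv') : μ.Extends (μ.insert a hv') := by
  intro b h₀ hb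
  by_cases hne : b = a
  · subst hne
    rw [ha, Option.some.injEq] at hb
    exact ⟨hv', Finmap.lookup_insert _, hb ▸ h⟩
  · exact ⟨h₀, by rw [Finmap.lookup_insert_of_ne _ hne, hb], .refl h₀⟩

theorem exists_fresh (μ : Heap) : ∃ a, a ∉ μ := by
  obtain ⟨a, ha⟩ := Infinite.exists_notMem_finset μ.keys
  exact ⟨a, fun h => ha (Finmap.mem_keys.2 h)⟩

end Heap

theorem lookup_cons_eq_none {M : List (Label × Value)} {l : Label} {v : Value} (x : Label)
    (h : ((l, v) :: M).lookup x = none) : M.lookup x = none := by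
  rw [List.lookup_cons] at h
  split at h
  · simp at h
  · exact h

/-- If the searches in a list of addresses terminate, they either all fail or there is a first
successful one. -/
theorem GetAttr.search {μ : Heap} {x : Label} {as : List Addr}
    (h : ∀ b ∈ as, ∃ o, GetAttr μ x b o) :
    (∀ b ∈ as, GetAttr μ x b none) ∨
      ∃ as₁ a as₂ v, as = as₁ ++ a :: as₂ ∧ (∀ b ∈ as₁, GetAttr μ x b none) ∧
        GetAttr μ x a (some v) := by
  induction as with
  | nil => exact .inl (by simp)
  | cons a as ih =>
    obtain ⟨o, ho⟩ := h a (by simp)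
    cases o with
    | some v => exact .inr ⟨[], a, as, v, rfl, by simp, ho⟩
    | none =>
      rcases ih fun b hb => h b (by simp [hb]) with hn | ⟨as₁, a', as₂, v, rfl, hn, hv⟩
      · exact .inl (List.forall_mem_cons.2 ⟨ho, hn⟩)
      · exact .inr ⟨a :: as₁, a', as₂, v, rfl, List.forall_mem_cons.2 ⟨ho, hn⟩, hv⟩

theorem GetAttr.total_cls {μ : Heap} {x : Label} {a : Addr} {as : List Addr}
    {M : List (Label × Value)} {c : Value} (ha : μ.lookup a = some (.cls as M c))
    (h : ∀ b ∈ as, ∃ o, GetAttr μ x b o) : ∃ o, GetAttr μ x a o := by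
  cases hM : M.lookup x with
  | some v => exact ⟨_, .clsHere ha hM⟩
  | none =>
    rcases search h with hn | ⟨as₁, a', as₂, v, rfl, hn, hv⟩
    · exact ⟨_, .clsNone ha hM hn⟩
    · exact ⟨_, .clsUp ha hM hn hv⟩

theorem GetAttr.total_obj {μ : Heap} {x : Label} {a a' : Addr} {M : List (Label × Value)}
    (ha : μ.lookup a = some (.obj a' M)) (h : ∃ o, GetAttr μ x a' o) :
    ∃ o, GetAttr μ x a o := by
  cases hM : M.lookup x with
  | some v => exact ⟨_, .objHere ha hM⟩
  | none =>
    obtain ⟨o, ho⟩ := h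
    exact ⟨o, .objUp ha hM ho⟩

theorem GetAttr.defined_cls {μ : Heap} {x : Label} {a b : Addr} {as₁ as₂ : List Addr}
    {M : List (Label × Value)} {c v : Value} (ha : μ.lookup a = some (.cls (as₁ ++ b :: as₂) M c))
    (h : ∀ b ∈ as₁, ∃ o, GetAttr μ x b o) (hb : GetAttr μ x b (some v)) :
    ∃ v, GetAttr μ x a (some v) := by
  cases hM : M.lookup x with
  | some v => exact ⟨_, .clsHere ha hM⟩
  | none =>
    rcases search h with hn | ⟨as₃, a', as₄, v', rfl, hn, hv⟩
    · exact ⟨v, .clsUp ha hM hn hb⟩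
    · exact ⟨v', .clsUp (by rw [ha, List.append_assoc, List.cons_append]) hM hn hv⟩

theorem GetAttr.extend {μ μ' : Heap} {x : Label} {a : Addr} {o : Option Value}
    (h : GetAttr μ x a o) (hμ : μ.Closed) (he : μ.Extends μ') (ha : a ∈ μ) :
    ∃ o', GetAttr μ' x a o' ∧ (o.isSome → o'.isSome) := by
  induction h with
  | dangling h => exact absurd h (Option.ne_none_iff_exists'.2 (Finmap.mem_iff.1 ha))
  | @objHere a a' M v h hM =>
    obtain ⟨_, h', hx⟩ := he _ _ h
    cases hx with
    | @obj _ _ M' hMM =>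
      cases hM' : M'.lookup x with
      | none => simp [hMM x hM'] at hM
      | some v' => exact ⟨_, .objHere h' hM', fun _ => rfl⟩
  | @objUp a a' M o h hM _ ih =>
    obtain ⟨o', ho', hs⟩ := ih (hμ _ _ h a' (by simp [HeapVal.parents]))
    obtain ⟨_, h', hx⟩ := he _ _ h
    cases hx with
    | @obj _ _ M' hMM =>
      cases hM' : M'.lookup x with
      | none => exact ⟨_, .objUp h' hM' ho', hs⟩
      | some v' => exact ⟨_, .objHere h' hM', fun _ => rfl⟩
  | @clsHere a as M c v h hM =>
    obtain ⟨_, h', hx⟩ := he _ _ h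
    cases hx with
    | @cls _ _ M' _ hMM =>
      cases hM' : M'.lookup x with
      | none => simp [hMM x hM'] at hM
      | some v' => exact ⟨_, .clsHere h' hM', fun _ => rfl⟩
  | @clsUp a a' as₁ as₂ M c v h hM _ _ ihn ihv =>
    have hp := hμ _ _ h
    simp only [HeapVal.parents, List.mem_append, List.mem_cons] at hp
    obtain ⟨o', ho', hs⟩ := ihv (hp a' (by simp))
    obtain ⟨v', rfl⟩ := Option.isSome_iff_exists.1 (hs rfl)
    obtain ⟨_, h', hx⟩ := he _ _ h
    cases hx with
    | cls hMM =>
      obtain ⟨w, hw⟩ := defined_cls h'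
        (fun b hb => (ihn b hb (hp b (.inl hb))).imp fun _ => And.left) ho'
      exact ⟨_, hw, fun _ => rfl⟩
  | @clsNone a as M c h hM _ ihn =>
    obtain ⟨_, h', hx⟩ := he _ _ h
    cases hx with
    | cls hMM =>
      obtain ⟨o', ho'⟩ := total_cls h' (x := x)
        fun b hb => (ihn b hb (hμ _ _ h b hb)).imp fun _ => And.left
      exact ⟨o', ho', by simp⟩

theorem HasAttrs.extend {μ μ' : Heap} {a : Addr} {δ : Finset Label} (h : HasAttrs μ a δ)
    (hμ : μ.Closed) (he : μ.Extends μ') (ha : a ∈ μ) : HasAttrs μ' a δ := by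
  intro x hx
  obtain ⟨v, hv⟩ := h x hx
  obtain ⟨o', ho', hs⟩ := hv.extend hμ he ha
  obtain ⟨v', rfl⟩ := Option.isSome_iff_exists.1 (hs rfl)
  exact ⟨v', ho'⟩

theorem HasAttrs.union {μ : Heap} {a : Addr} {δ δ' : Finset Label} (h : HasAttrs μ a δ)
    (h' : HasAttrs μ a δ') : HasAttrs μ a (δ ∪ δ') :=
  fun x hx => (Finset.mem_union.1 hx).elim (h x) (h' x)

theorem ParamMatch.extend {μ μ' : Heap} {e : Expr} {C : Arity} (h : ParamMatch μ e C)
    (he : μ.Extends μ') : ParamMatch μ' e C := by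
  induction h with
  | fnAny => exact .fnAny
  | fnNum h => exact .fnNum h
  | clsAny h =>
    obtain ⟨_, h', hx⟩ := he _ _ h
    cases hx
    exact .clsAny h'
  | clsNum h _ ih =>
    obtain ⟨_, h', hx⟩ := he _ _ h
    cases hx
    exact .clsNum h' ih

theorem ParamMatch.num_unique {μ : Heap} {e : Expr} {m n : ℕ} (h : ParamMatch μ e (.num m))
    (h' : ParamMatch μ e (.num n)) : m = n := by
  generalize hC : Arity.num m = C at h
  induction h generalizing m n with
  | fnAny => cases hC
  | clsAny => cases hC
  | fnNum h => cases hC; cases h' with | fnNum h' => rw [← h, ← h']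
  | clsNum h _ ih =>
    cases hC
    cases h' with
    | clsNum h₂ h' =>
      rw [h, Option.some.injEq, HeapVal.cls.injEq] at h₂
      obtain ⟨-, -, rfl⟩ := h₂
      simpa using ih h' rfl

/-! ### Well-typed heaps -/

theorem AddrOk.mem {H : HeapTy} {μ : Heap} {a : Addr} {S : Tag} (h : AddrOk H μ a S) :
    a ∈ μ := by
  cases h with
  | cls h => exact Finmap.mem_iff.2 ⟨_, h⟩
  | obj h => exact Finmap.mem_iff.2 ⟨_, h⟩

theorem AddrOk.attrs {H : HeapTy} {μ : Heap} {a : Addr} {S : Tag} {h : HeapVal}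
    (hok : AddrOk H μ a S) (ha : μ.lookup a = some h) :
    ∀ m ∈ h.attrs, HasType H .empty m.2.1 .pyobj := by
  cases hok with
  | cls h' _ _ _ hv => cases ha.symm.trans h'; exact hv
  | obj h' _ _ hv => cases ha.symm.trans h'; exact hv

theorem AddrOk.parents {H : HeapTy} {μ : Heap} {a : Addr} {S : Tag} {h : HeapVal}
    (hok : AddrOk H μ a S) (ha : μ.lookup a = some h) :
    ∀ b ∈ h.parents, ∃ δ C, H.lookup b = some (.cls δ C) := by
  cases hok with
  | cls h' _ _ hs => cases ha.symm.trans h'; exact hs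
  | obj h' _ hs => cases ha.symm.trans h'; simpa [HeapVal.parents] using hs

theorem AddrOk.extend {H H' : HeapTy} {μ μ' : Heap} {a : Addr} {S : Tag} (h : AddrOk H μ a S)
    (hH : H.Refines H') (hμ : μ.Closed) (he : μ.Extends μ')
    (hM : ∀ h', μ'.lookup a = some h' → ∀ m ∈ h'.attrs, HasType H' .empty m.2.1 .pyobj) :
    AddrOk H' μ' a S := by
  have hmem := h.mem
  cases h with
  | cls h hδ hC hs hv hc =>
    obtain ⟨_, h', hx⟩ := he _ _ h
    cases hx
    exact .cls h' (hδ.extend hμ he hmem) (hC.extend he)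
      (fun b hb => hH.exists_cls (hs b hb)) (hM _ h') (hc.refine hH)
  | obj h hδ hs hv =>
    obtain ⟨_, h', hx⟩ := he _ _ h
    cases hx
    exact .obj h' (hδ.extend hμ he hmem) (hH.exists_cls hs) (hM _ h')

/-- Well-typed heaps in which attribute lookup terminates. -/
structure HeapWf (H : HeapTy) (μ : Heap) : Prop where
  ok : HeapOk H μ
  total : μ.Total

namespace HeapWf

variable {H : HeapTy} {μ : Heap}

theorem mem_of_lookup (h : HeapWf H μ) {a : Addr} {S : Tag} (ha : H.lookup a = some S) : a ∈ μ :=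
  (h.ok.2 a S ha).mem

theorem addrOk (h : HeapWf H μ) {a : Addr} {hv : HeapVal} (ha : μ.lookup a = some hv) :
    ∃ S, H.lookup a = some S ∧ AddrOk H μ a S := by
  obtain ⟨S, hS⟩ := Finmap.mem_iff.1 ((h.ok.1 a).2 (Finmap.mem_iff.2 ⟨hv, ha⟩))
  exact ⟨S, hS, h.ok.2 a S hS⟩

theorem closed (h : HeapWf H μ) : μ.Closed := by
  intro a hv ha b hb
  obtain ⟨S, -, hok⟩ := h.addrOk ha
  obtain ⟨δ, C, hb⟩ := hok.parents ha b hb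
  exact h.mem_of_lookup hb

theorem attrs (h : HeapWf H μ) {a : Addr} {hv : HeapVal} (ha : μ.lookup a = some hv) :
    ∀ m ∈ hv.attrs, HasType H .empty m.2.1 .pyobj := by
  obtain ⟨S, -, hok⟩ := h.addrOk ha
  exact hok.attrs ha

theorem exists_cls_of_lookup (h : HeapWf H μ) {a : Addr} {as : List Addr}
    {M : List (Label × Value)} {c : Value} (ha : μ.lookup a = some (.cls as M c)) :
    ∃ δ C, H.lookup a = some (.cls δ C) := by
  obtain ⟨S, hS, hok⟩ := h.addrOk ha
  cases hok with
  | cls => exact ⟨_, _, hS⟩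
  | obj h' => simp [ha] at h'

theorem getAttr (h : HeapWf H μ) {x : Label} {a : Addr} {o : Option Value}
    (hg : GetAttr μ x a o) : ∀ v, o = some v → HasType H .empty v.1 .pyobj := by
  have key : ∀ {a : Addr} {hv : HeapVal} {v w : Value}, μ.lookup a = some hv →
      hv.attrs.lookup x = some v → some v = some w → HasType H .empty w.1 .pyobj := by
    intro a hv v w ha hM hvw
    cases hvw
    obtain ⟨l₁, l₂, hl, -⟩ := List.lookup_eq_some_iff.1 hM
    exact h.attrs ha (x, v) (by simp [hl])
  induction hg with
  | dangling => simp
  | objHere ha hM => exact fun _ => key ha hM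
  | objUp _ _ _ ih => exact ih
  | clsHere ha hM => exact fun _ => key ha hM
  | clsUp _ _ _ _ _ ih => exact ih
  | clsNone => simp

theorem refine (h : HeapWf H μ) {a : Addr} {S₀ S : Tag} (ha : H.lookup a = some S₀)
    (hle : S.Le S₀) (hok : AddrOk H μ a S) :
    H.Refines (H.insert a S) ∧ HeapWf (H.insert a S) μ := by
  have hr : H.Refines (H.insert a S) := .insert fun S₁ h₁ => by
    rw [ha, Option.some.injEq] at h₁
    exact h₁ ▸ hle
  refine ⟨hr, ⟨fun b => ?_, fun b T hb => ?_⟩, h.total⟩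
  · rw [Finmap.mem_insert, ← h.ok.1 b, or_iff_right_iff_imp]
    rintro rfl
    exact Finmap.mem_iff.2 ⟨_, ha⟩
  · have hb' : AddrOk H μ b T := by
      by_cases hne : b = a
      · subst hne
        rw [Finmap.lookup_insert, Option.some.injEq] at hb
        exact hb ▸ hok
      · rw [Finmap.lookup_insert_of_ne _ hne] at hb
        exact h.ok.2 b T hb
    exact hb'.extend hr h.closed (.refl μ) fun h' hl m hm => (h.attrs hl m hm).refine hr

theorem total_extend (h : HeapWf H μ) {μ' : Heap} (he : μ.Extends μ') :
    ∀ x, ∀ a ∈ μ, ∃ o, GetAttr μ' x a o := by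
  intro x a ha
  obtain ⟨o, ho⟩ := h.total x a ha
  obtain ⟨o', ho', -⟩ := ho.extend h.closed he ha
  exact ⟨o', ho'⟩

theorem update (h : HeapWf H μ) {a : Addr} {hv hv' : HeapVal} (ha : μ.lookup a = some hv)
    (he : hv.Extends hv') (hM : ∀ m ∈ hv'.attrs, HasType H .empty m.2.1 .pyobj) :
    HeapWf H (μ.insert a hv') := by
  have hx := Heap.extends_insert ha he
  have hmem : ∀ b, b ∈ μ.insert a hv' ↔ b ∈ μ := fun b => by
    rw [Finmap.mem_insert, or_iff_right_iff_imp]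
    rintro rfl
    exact Finmap.mem_iff.2 ⟨_, ha⟩
  refine ⟨⟨fun b => by rw [hmem, h.ok.1 b], fun b T hb => ?_⟩,
    fun x b hb => h.total_extend hx x b ((hmem b).1 hb)⟩
  refine (h.ok.2 b T hb).extend (.refl H) h.closed hx fun h' hl => ?_
  by_cases hne : b = a
  · subst hne
    rw [Finmap.lookup_insert, Option.some.injEq] at hl
    exact hl ▸ hM
  · rw [Finmap.lookup_insert_of_ne _ hne] at hl
    exact h.attrs hl

theorem alloc (h : HeapWf H μ) {a : Addr} {hv : HeapVal} {S : Tag} (ha : a ∉ μ)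
    (hp : ∀ b ∈ hv.parents, b ∈ μ)
    (hok : ∀ H', H.Refines H' → AddrOk H' (μ.insert a hv) a S) :
    H.Refines (H.insert a S) ∧ HeapWf (H.insert a S) (μ.insert a hv) := by
  have hx := Heap.extends_insert_fresh ha hv
  have hr : H.Refines (H.insert a S) := .insert fun S₀ h₀ => absurd (h.mem_of_lookup h₀) ha
  refine ⟨hr, ⟨fun b => by rw [Finmap.mem_insert, Finmap.mem_insert, h.ok.1 b],
    fun b T hb => ?_⟩, fun x b hb => ?_⟩
  · by_cases hne : b = a
    · subst hne
      rw [Finmap.lookup_insert, Option.some.injEq] at hb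
      exact hb ▸ hok _ hr
    · rw [Finmap.lookup_insert_of_ne _ hne] at hb
      refine (h.ok.2 b T hb).extend hr h.closed hx fun h' hl m hm => ?_
      rw [Finmap.lookup_insert_of_ne _ hne] at hl
      exact (h.attrs hl m hm).refine hr
  · rcases Finmap.mem_insert.1 hb with rfl | hb
    · have hl : (μ.insert b hv).lookup b = some hv := Finmap.lookup_insert _
      cases hv with
      | cls as M c =>
        exact GetAttr.total_cls hl fun b' hb' => h.total_extend hx x b' (hp b' hb')
      | obj a' M =>
        exact GetAttr.total_obj hl (h.total_extend hx x a' (hp a' (by simp [HeapVal.parents])))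
    · exact h.total_extend hx x b hb

end HeapWf

theorem heapWf_empty : HeapWf ∅ ∅ :=
  ⟨⟨fun _ => by simp [Finmap.notMem_empty], fun a S h => by simp at h⟩,
    fun _ a h => absurd h (Finmap.notMem_empty)⟩

/-! ### Values of given tags -/

theorem HasType.addr_inv {H : HeapTy} {Γ : Env Tag} {a : Addr} {S : Tag}
    (h : HasType H Γ (.addr a) S) : ∃ S₀, H.lookup a = some S₀ ∧ S₀.Le S := by
  obtain ⟨S₀, hd, hle⟩ := h.exists_direct
  cases hd with
  | addr ha => exact ⟨S₀, ha, hle⟩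

theorem HasType.fn_inv {H : HeapTy} {Γ : Env Tag} {xs : List Var} {e : Expr} {S : Tag}
    (h : HasType H Γ (.fn xs e) S) :
    HasType H (Γ.extend (xs.map fun x => (x, Tag.pyobj))) e .pyobj ∧ (Tag.fn xs.length).Le S := by
  obtain ⟨S₀, hd, hle⟩ := h.exists_direct
  cases hd with
  | fn he => exact ⟨he, hle⟩

theorem HasType.value_obj {H : HeapTy} {Γ : Env Tag} {v : Value} {δ : Finset Label}
    (h : HasType H Γ v.1 (.obj δ)) : ∃ a, v.1 = .addr a := by
  obtain ⟨v, hv⟩ := v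
  obtain ⟨S₀, hd, hle⟩ := h.exists_direct
  cases hv with
  | addr a => exact ⟨a, rfl⟩
  | num => cases hd; exact hle.elim
  | fn => cases hd; exact hle.elim

theorem HasType.value_cls {H : HeapTy} {Γ : Env Tag} {v : Value} {δ : Finset Label} {C : Arity}
    (h : HasType H Γ v.1 (.cls δ C)) : ∃ a, v.1 = .addr a := by
  obtain ⟨v, hv⟩ := v
  obtain ⟨S₀, hd, hle⟩ := h.exists_direct
  cases hv with
  | addr a => exact ⟨a, rfl⟩
  | num => cases hd; exact hle.elim
  | fn => cases hd; exact hle.elim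

theorem HeapWf.value_fn {H : HeapTy} {μ : Heap} (hw : HeapWf H μ) {v : Value} {n : ℕ}
    (h : HasType H .empty v.1 (.fn n)) :
    (∃ xs e, v.1 = .fn xs e ∧ xs.length = n) ∨
      ∃ a as M c, v.1 = .addr a ∧ μ.lookup a = some (.cls as M c) ∧
        ParamMatch μ c.1 (.num (n + 1)) := by
  obtain ⟨v, hv⟩ := v
  obtain ⟨S₀, hd, hle⟩ := h.exists_direct
  cases hv with
  | num => cases hd; exact hle.elim
  | fn xs e => cases hd; exact .inl ⟨xs, e, rfl, hle⟩
  | addr a =>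
    cases hd with
    | addr ha =>
      cases hw.ok.2 _ _ ha with
      | obj => exact hle.elim
      | cls hl _ hC =>
        cases (hle : _ = Arity.num n)
        cases hC with
        | clsNum hl' hc => exact .inr ⟨a, _, _, _, rfl, hl', hc⟩

theorem HeapWf.paramMatch {H : HeapTy} {μ : Heap} (hw : HeapWf H μ) {v : Value} {n : ℕ}
    (h : HasType H .empty v.1 (.fn n)) : ParamMatch μ v.1 (.num n) := by
  rcases hw.value_fn h with ⟨xs, e, hv, hn⟩ | ⟨a, as, M, c, hv, hl, hc⟩
  · rw [hv]
    exact .fnNum hn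
  · rw [hv]
    exact .clsNum hl hc

theorem ParamMatch.any {μ : Heap} {e : Expr} {C : Arity} (h : ParamMatch μ e C) :
    ParamMatch μ e .any := by
  cases h with
  | fnAny => exact .fnAny
  | fnNum => exact .fnAny
  | clsAny h => exact .clsAny h
  | clsNum h => exact .clsAny h

theorem HeapWf.exists_lookup_cls {H : HeapTy} {μ : Heap} (hw : HeapWf H μ) {a : Addr}
    {δ : Finset Label} {C : Arity} (h : HasType H .empty (.addr a) (.cls δ C)) :
    (∃ as M c, μ.lookup a = some (.cls as M c)) ∧ HasAttrs μ a δ := by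
  obtain ⟨S₀, ha, hle⟩ := h.addr_inv
  obtain ⟨δ', C', rfl, hδ, -⟩ := hle.to_cls
  cases hw.ok.2 _ _ ha with
  | cls hl hδ' => exact ⟨⟨_, _, _, hl⟩, fun x hx => hδ' x (hδ hx)⟩

theorem HeapWf.hasAttrs {H : HeapTy} {μ : Heap} (hw : HeapWf H μ) {a : Addr}
    {δ : Finset Label} (h : HasType H .empty (.addr a) (.obj δ)) : HasAttrs μ a δ := by
  obtain ⟨S₀, ha, hle⟩ := h.addr_inv
  cases hw.ok.2 _ _ ha with
  | cls hl hδ' => exact fun x hx => hδ' x (hle hx)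
  | obj hl hδ' => exact fun x hx => hδ' x (hle hx)

/-! ### Casts refine the heap type -/

theorem ParamMatch.meet {μ : Heap} {e : Expr} {C C' : Arity} (h : ParamMatch μ e C)
    (h' : ParamMatch μ e C') :
    ∃ C₀, ParamMatch μ e C₀ ∧ (C = C₀ ∨ C = .any) ∧ (C' = C₀ ∨ C' = .any) := by
  cases C' with
  | any => exact ⟨C, h, .inl rfl, .inr rfl⟩
  | num n =>
    refine ⟨.num n, h', ?_, .inl rfl⟩
    cases C with
    | any => exact .inr rfl
    | num m => exact .inl (congrArg _ (h.num_unique h'))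

theorem AddrOk.check {H : HeapTy} {μ : Heap} {a : Addr} {S₀ S : Tag} (h : AddrOk H μ a S₀)
    (hc : Check μ (.addr a) S) : ∃ S', S'.Le S₀ ∧ S'.Le S ∧ AddrOk H μ a S' := by
  have hsub {δ δ' : Finset Label} : δ ⊆ δ ∪ δ' ∧ δ' ⊆ δ ∪ δ' :=
    ⟨Finset.subset_union_left, Finset.subset_union_right⟩
  cases hc with
  | pyobj => exact ⟨S₀, .refl _, .top _, h⟩
  | obj hδ' =>
    cases h with
    | cls hl hδ hC hs hM hv =>
      exact ⟨.cls _ _, ⟨hsub.1, .inl rfl⟩, hsub.2, .cls hl (hδ.union hδ') hC hs hM hv⟩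
    | obj hl hδ hs hM => exact ⟨_, hsub.1, hsub.2, .obj hl (hδ.union hδ') hs hM⟩
  | clsFn hl' hp =>
    cases h with
    | cls hl hδ hC hs hM hv =>
      obtain ⟨C₀, hC₀, h₁, h₂⟩ := hC.meet (.clsNum hl' hp)
      cases h₂ with
      | inl h₂ => exact ⟨.cls _ _, ⟨subset_rfl, h₁⟩, h₂.symm, .cls hl hδ hC₀ hs hM hv⟩
      | inr h₂ => cases h₂
    | obj hl => cases hl.symm.trans hl'
  | cls hl' hp hδ' =>
    cases h with
    | cls hl hδ hC hs hM hv =>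
      obtain ⟨C₀, hC₀, h₁, h₂⟩ := hC.meet hp
      exact ⟨.cls _ _, ⟨hsub.1, h₁⟩, ⟨hsub.2, h₂⟩, .cls hl (hδ.union hδ') hC₀ hs hM hv⟩
    | obj hl => cases hl.symm.trans hl'

theorem HeapWf.check {H : HeapTy} {μ : Heap} (hw : HeapWf H μ) {v : Value} {S : Tag}
    (hv : HasType H .empty v.1 .pyobj) (hc : Check μ v.1 S) :
    ∃ H', H.Refines H' ∧ HeapWf H' μ ∧ HasType H' .empty v.1 S := by
  obtain ⟨v, hval⟩ := v
  cases hval with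
  | num n =>
    refine ⟨H, .refl H, hw, ?_⟩
    cases hc with
    | pyobj => exact hv
    | int => exact .num
  | fn xs e =>
    refine ⟨H, .refl H, hw, ?_⟩
    cases hc with
    | pyobj => exact hv
    | fn hn => exact hn ▸ .fn hv.fn_inv.1
  | addr a =>
    obtain ⟨S₀, ha, -⟩ := hv.addr_inv
    obtain ⟨S', hle, hle', hok⟩ := (hw.ok.2 a S₀ ha).check hc
    obtain ⟨hr, hw'⟩ := hw.refine ha hle hok
    exact ⟨_, hr, hw', (HasType.addr (Finmap.lookup_insert _)).of_le hle'⟩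

theorem HeapWf.value_fn_of_paramMatch {H : HeapTy} {μ : Heap} (hw : HeapWf H μ) {v : Value}
    {n : ℕ} (hv : HasType H .empty v.1 .pyobj) (hp : ParamMatch μ v.1 (.num n)) :
    ∃ H', H.Refines H' ∧ HeapWf H' μ ∧ HasType H' .empty v.1 (.fn n) := by
  refine hw.check hv ?_
  generalize v.1 = e at hp
  cases hp with
  | fnNum h => exact .fn h
  | clsNum h h' => exact .clsFn h h'

/-! ### Preservation -/

/-- Results that are well-typed, and blame at most untyped code. -/
def Result.Ok (H : HeapTy) (S : Tag) : Result → Prop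
  | .conf e μ => ∃ H', H.Refines H' ∧ HeapWf H' μ ∧ HasType H' .empty e S
  | .castError => True
  | .pyError p => p = .untyped

theorem Result.Ok.of_le {H : HeapTy} {S S' : Tag} {r : Result} (h : r.Ok H S) (hle : S.Le S') :
    r.Ok H S' := by
  cases r with
  | conf e μ =>
    obtain ⟨H', hr, hw, he⟩ := h
    exact ⟨H', hr, hw, he.of_le hle⟩
  | castError => trivial
  | pyError p => exact h

theorem zip_map_const {α β γ : Type} (c : γ) {xs : List α} {vs : List β}
    (h : xs.length = vs.length) : xs.zip (vs.map fun _ => c) = xs.map fun x => (x, c) := by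
  induction xs generalizing vs with
  | nil => simp
  | cons x xs ih => cases vs <;> simp_all

theorem HasType.subst_call {H : HeapTy} {xs : List Var} {vs : List Value} {e : Expr} {S : Tag}
    (hf : HasType H .empty (.fn xs e) S) (hn : xs.length = vs.length)
    (hvs : ∀ e ∈ vs.map Subtype.val, HasType H .empty e .pyobj) :
    HasType H .empty (e.subst (.ofLists xs vs)) .pyobj := by
  refine HasType.subst_ofLists (ts := vs.map fun _ => .pyobj) hn ?_ ?_
  · rw [List.forall₂_map_right_iff]
    exact List.forall₂_same.2 fun v hv => hvs v.1 (List.mem_map_of_mem hv)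
  · rw [zip_map_const _ hn]
    exact hf.fn_inv.1

theorem HeapWf.construct {H : HeapTy} {μ : Heap} (hw : HeapWf H μ) {a a' : Addr}
    {as : List Addr} {M : List (Label × Value)} {c : Value}
    (hl : μ.lookup a = some (.cls as M c)) (ha' : a' ∉ μ) :
    ∃ H', H.Refines H' ∧ HeapWf H' (μ.insert a' (.obj a [])) ∧
      HasType H' .empty (.addr a') .pyobj := by
  obtain ⟨hr, hw'⟩ := hw.alloc (hv := .obj a []) (S := .obj ∅) ha'
    (by simpa [HeapVal.parents] using Finmap.mem_iff.2 ⟨_, hl⟩) fun H' hr =>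
      .obj (Finmap.lookup_insert _) (fun x hx => by simp at hx)
        (hr.exists_cls (hw.exists_cls_of_lookup hl)) (by simp)
  exact ⟨_, hr, hw', (HasType.addr (Finmap.lookup_insert _)).pyobj⟩

theorem exists_lookup_of_mem_memberLabels {M : List (Label × Value)} {x : Label}
    (h : x ∈ memberLabels (valueMembers M)) : ∃ v, M.lookup x = some v := by
  simp only [memberLabels, valueMembers, List.map_map, List.mem_toFinset, List.mem_map,
    Function.comp_apply] at h
  obtain ⟨m, hm, rfl⟩ := h
  rw [← Option.ne_none_iff_exists']
  intro hn
  exact absurd (List.lookup_eq_none_iff.1 hn m hm) (by simp)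

theorem mem_foldr_union {δs : List (Finset Label)} {x : Label} :
    x ∈ δs.foldr (· ∪ ·) ∅ ↔ ∃ δ ∈ δs, x ∈ δ := by
  induction δs with
  | nil => simp
  | cons δ δs ih => simp [ih]

theorem HeapWf.defineClass {H : HeapTy} {μ : Heap} (hw : HeapWf H μ) {as : List Addr}
    {M : List (Label × Value)} {c : Value} {a' : Addr} {δ : Finset Label} {C : Arity}
    (has : ∀ a ∈ as, ∃ as' M' v', μ.lookup a = some (.cls as' M' v'))
    (hM : ∀ m ∈ valueMembers M, HasType H .empty m.2 .pyobj)
    (hc : HasType H .empty c.1 .pyobj) (ha' : a' ∉ μ)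
    (hC : C = .any ∨ ∃ n, C = .num n ∧ ParamMatch μ c.1 (.num (n + 1)))
    (hδ : ∀ x ∈ δ, x ∈ memberLabels (valueMembers M) ∨ ∃ a ∈ as, HasAttrs μ a {x}) :
    ∃ H', H.Refines H' ∧ HeapWf H' (μ.insert a' (.cls as M c)) ∧
      HasType H' .empty (.addr a') (.cls δ C) := by
  have hmem : ∀ a ∈ as, a ∈ μ := fun a ha => by
    obtain ⟨_, _, _, h⟩ := has a ha
    exact Finmap.mem_iff.2 ⟨_, h⟩
  have hx := Heap.extends_insert_fresh ha' (.cls as M c)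
  have hl : (μ.insert a' (.cls as M c)).lookup a' = some (.cls as M c) := Finmap.lookup_insert _
  obtain ⟨hr, hw'⟩ := hw.alloc (hv := .cls as M c) (S := .cls δ C) ha' hmem fun H' hr => by
    refine .cls hl (fun x hxδ => ?_) ?_ (fun a ha => ?_) (fun m hm => ?_) (hc.refine hr)
    · rcases hδ x hxδ with hxM | ⟨a, ha, hax⟩
      · obtain ⟨v, hv⟩ := exists_lookup_of_mem_memberLabels hxM
        exact ⟨v, .clsHere hl hv⟩
      · obtain ⟨v, hv⟩ := hax.extend hw.closed hx (hmem a ha) x (by simp)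
        obtain ⟨as₁, as₂, rfl⟩ := List.append_of_mem ha
        exact GetAttr.defined_cls hl
          (fun b hb => hw.total_extend hx x b (hmem b (by simp [hb]))) hv
    · rcases hC with rfl | ⟨n, rfl, hp⟩
      · exact .clsAny hl
      · exact .clsNum hl (hp.extend hx)
    · obtain ⟨_, _, _, h⟩ := has a ha
      exact hr.exists_cls (hw.exists_cls_of_lookup h)
    · exact (hM (m.1, m.2.1) (List.mem_map.2 ⟨m, hm, rfl⟩)).refine hr
  exact ⟨_, hr, hw', .addr (Finmap.lookup_insert _)⟩

theorem Env.extend_const {α : Type} (Γ : Env α) (c : α) {xs : List Var} {x : Var}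
    (h : x ∈ xs) : Γ.extend (xs.map fun x => (x, c)) x = some c := by
  induction xs generalizing Γ with
  | nil => simp at h
  | cons y xs ih =>
    simp only [List.map_cons, extend]
    by_cases hx : x ∈ xs
    · exact ih _ hx
    · rw [extend_eq_of_notMem (by simpa [Function.comp_def] using hx)]
      simp only [List.mem_cons, hx, or_false] at h
      simp [bind, h]

theorem HasType.app_of_length {H : HeapTy} {Γ : Env Tag} {e : Expr} {es : List Expr}
    (he : HasType H Γ e (.fn es.length)) (hes : ∀ e' ∈ es, HasType H Γ e' .pyobj)
    (p : Origin) : HasType H Γ (.app e es p) .pyobj := by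
  cases p with
  | typed => exact .app he hes rfl
  | untyped => exact .appDyn he.pyobj hes

theorem HeapWf.lookup_ok {H : HeapTy} {μ : Heap} (hw : HeapWf H μ) {a : Addr} {l : Label}
    {p : Origin} {h : HeapVal} {r : Result} (ha : μ.lookup a = some h)
    (hr : Lookup μ a l p h r) : r.Ok H .pyobj := by
  cases hr with
  | own hM => exact ⟨H, .refl H, hw, hw.getAttr (.objHere ha hM) _ rfl⟩
  | field hM hg => exact ⟨H, .refl H, hw, hw.getAttr hg _ rfl⟩
  | @method _ _ v xs ys e hM hg hv hlen hnd =>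
    have hvt := hw.getAttr hg _ rfl
    rw [hv] at hvt ⊢
    have hf : HasType H .empty (.fn xs e) (.fn xs.length) := .fn hvt.fn_inv.1
    obtain ⟨S, hS, -⟩ := hw.addrOk ha
    refine ⟨H, .refl H, hw, (HasType.fn (.app_of_length ?_ ?_ p)).pyobj⟩
    · simpa [hlen] using hf.of_empty _
    · refine List.forall_mem_cons.2 ⟨(HasType.addr hS).pyobj, ?_⟩
      exact List.forall_mem_map.2 fun y hy => .var (Env.extend_const _ _ hy)
  | nullary => trivial
  | cls hg => exact ⟨H, .refl H, hw, hw.getAttr hg _ rfl⟩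

theorem exists_lookup {μ : Heap} {a : Addr} {l : Label} {v : Value} (p : Origin)
    (hg : GetAttr μ l a (some v)) : ∃ h r, μ.lookup a = some h ∧ Lookup μ a l p h r := by
  have ha : ∃ h, μ.lookup a = some h := by cases hg <;> exact ⟨_, ‹_›⟩
  obtain ⟨h, ha⟩ := ha
  refine ⟨h, ?_⟩
  cases h with
  | cls as M c => exact ⟨_, ha, .cls hg⟩
  | obj a' M =>
    cases hM : M.lookup l with
    | some w => exact ⟨_, ha, .own hM⟩
    | none =>
      by_cases hf : ∃ xs e, v.1 = .fn xs e
      · obtain ⟨xs, e, hv⟩ := hf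
        cases xs with
        | nil => exact ⟨_, ha, .nullary hM hg hv⟩
        | cons x xs =>
          exact ⟨_, ha, .method hM hg hv (ys := List.range xs.length) (by simp)
            List.nodup_range⟩
      · exact ⟨_, ha, .field hM hg fun xs e hv => hf ⟨xs, e, hv⟩⟩

theorem HeapWf.call_ok {H : HeapTy} {μ : Heap} (hw : HeapWf H μ) {a a' : Addr} {as : List Addr}
    {M : List (Label × Value)} {c : Value} {es : List Expr} {x : Var} {p : Origin}
    (hl : μ.lookup a = some (.cls as M c)) (ha' : a' ∉ μ)
    (hes : ∀ e ∈ es, HasType H .empty e .pyobj)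
    (hp : p = .untyped ∨ ParamMatch μ c.1 (.num (es.length + 1))) :
    (Result.conf (.letIn x (.app c.1 (.addr a' :: es) p) (.addr a'))
      (μ.insert a' (.obj a []))).Ok H .pyobj := by
  have hc : HasType H .empty c.1 .pyobj := by
    obtain ⟨S, -, hok⟩ := hw.addrOk hl
    cases hok with
    | cls h _ _ _ _ hc => cases hl.symm.trans h; exact hc
    | obj h => cases hl.symm.trans h
  obtain ⟨H₁, hr₁, hw₁, hc₁⟩ : ∃ H₁, H.Refines H₁ ∧ HeapWf H₁ μ ∧
      (HasType H₁ .empty c.1 .pyobj ∧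
        (p = .untyped ∨ HasType H₁ .empty c.1 (.fn (es.length + 1)))) := by
    rcases hp with hp | hp
    · exact ⟨H, .refl H, hw, hc, .inl hp⟩
    · obtain ⟨H₁, hr, hw₁, hc₁⟩ := hw.value_fn_of_paramMatch hc hp
      exact ⟨H₁, hr, hw₁, hc₁.pyobj, .inr hc₁⟩
  obtain ⟨H₂, hr₂, hw₂, hat⟩ := hw₁.construct hl ha'
  have hr := hr₁.trans hr₂
  have hargs : ∀ e ∈ Expr.addr a' :: es, HasType H₂ .empty e .pyobj :=
    List.forall_mem_cons.2 ⟨hat, fun e he => (hes e he).refine hr⟩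
  refine ⟨H₂, hr, hw₂, .letIn (S₁ := .pyobj) ?_ (hat.of_empty _)⟩
  rcases hc₁ with ⟨hc₁, rfl | hf⟩
  · exact .appDyn (hc₁.refine hr₂) hargs
  · exact .app_of_length (hf.refine hr₂) hargs p

theorem DirectType.set_inv {H : HeapTy} {Γ : Env Tag} {e₁ e₂ : Expr} {l : Label} {p : Origin}
    {S : Tag} (h : DirectType H Γ (.set e₁ l p e₂) S) : S = .int ∧ HasType H Γ e₂ .pyobj := by
  cases h with
  | setDyn _ h => exact ⟨rfl, h⟩
  | set _ h => exact ⟨rfl, h⟩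

theorem Red.ok {e : Expr} {μ : Heap} {r : Result} (h : Red e μ r) {H : HeapTy} {S : Tag}
    (hw : HeapWf H μ) (he : HasType H .empty e S) : r.Ok H S := by
  obtain ⟨S₀, hd, hle⟩ := he.exists_direct
  refine Result.Ok.of_le ?_ hle
  cases h with
  | check hc => cases hd with | check hv => exact hw.check hv hc
  | checkFail => trivial
  | app hn =>
    cases hd with
    | appDyn hf hvs => exact ⟨H, .refl H, hw, hf.subst_call hn hvs⟩
    | app hf hvs => exact ⟨H, .refl H, hw, hf.subst_call hn hvs⟩
  | appCls hl ha' =>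
    cases hd with
    | appDyn hf hvs => exact hw.call_ok hl ha' hvs (.inl rfl)
    | app hf hvs =>
      refine hw.call_ok hl ha' hvs (.inr ?_)
      rcases hw.value_fn (v := ⟨_, .addr _⟩) hf with ⟨_, _, hv, -⟩ | ⟨a, as, M, c, hv, hl', hc⟩
      · cases hv
      · cases hv
        cases hl.symm.trans hl'
        exact hc
  | appFail hnf hnc =>
    cases hd with
    | appDyn => rfl
    | app hf hvs =>
      rcases hw.value_fn hf with ⟨xs, e, hv, hn⟩ | ⟨a, as, M, c, hv, hl, -⟩
      · exact absurd ⟨xs, e, hv, by simpa using hn⟩ hnf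
      · exact absurd ⟨a, as, M, c, hv, hl⟩ hnc
  | @letIn x v e =>
    cases hd with
    | letIn hv he =>
      exact ⟨H, .refl H, hw, .subst_ofLists rfl (.cons hv .nil) he⟩
  | @cls as M v a' p _ has hp ha' =>
    cases hd with
    | clsDyn hs hM hc =>
      exact hw.defineClass has hM hc ha' (.inl rfl) fun x hx => .inl hx
    | cls hs hM hc =>
      refine hw.defineClass has hM hc.pyobj ha' (.inr ⟨_, rfl, hw.paramMatch hc⟩) fun x hx => ?_
      rw [Finset.mem_union, mem_foldr_union] at hx
      refine hx.imp_right fun ⟨δ, hδ, hxδ⟩ => ?_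
      obtain ⟨i, hi, rfl⟩ := List.getElem_of_mem hδ
      obtain ⟨hlen, hs⟩ := forall₂_iff_getElem.1 hs
      have hi' : i < as.length := by rw [List.length_map] at hlen; rwa [hlen]
      have hsi := hs i (by simpa using hi') hi
      rw [List.getElem_map] at hsi
      refine ⟨as[i], List.getElem_mem hi', fun y hy => ?_⟩
      rw [Finset.mem_singleton.1 hy]
      exact (hw.exists_lookup_cls hsi).2 x hxδ
  | @clsFail vs M v p _ hfail =>
    cases hd with
    | clsDyn => rfl
    | cls hs hM hc =>
      refine absurd ⟨fun u hu => ?_, (hw.paramMatch hc).any⟩ hfail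
      obtain ⟨i, hi, rfl⟩ := List.getElem_of_mem hu
      obtain ⟨hlen, hs⟩ := forall₂_iff_getElem.1 hs
      have hsi := hs i (by simpa using hi) (by simpa [← hlen] using hi)
      rw [List.getElem_map] at hsi
      obtain ⟨a, ha⟩ := hsi.value_cls
      rw [ha] at hsi
      obtain ⟨⟨as', M', c', hl⟩, -⟩ := hw.exists_lookup_cls hsi
      exact ⟨a, as', M', c', ha, hl⟩
  | get ha hl =>
    cases hd with
    | getDyn => exact hw.lookup_ok ha hl
    | get => exact hw.lookup_ok ha hl
  | @getFail v l p _ hfail =>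
    cases hd with
    | getDyn => rfl
    | get hv =>
      obtain ⟨a, ha⟩ := hv.value_obj
      rw [ha] at hv
      obtain ⟨w, hg⟩ := hw.hasAttrs hv l (by simp)
      obtain ⟨h, r, hl, hr⟩ := exists_lookup .typed hg
      exact absurd ⟨a, h, r, ha, hl, hr⟩ hfail
  | setObj hl =>
    obtain ⟨rfl, hv⟩ := hd.set_inv
    exact ⟨H, .refl H, hw.update hl (.obj lookup_cons_eq_none)
      (List.forall_mem_cons.2 ⟨hv, hw.attrs hl⟩), .num⟩
  | setCls hl =>
    obtain ⟨rfl, hv⟩ := hd.set_inv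
    exact ⟨H, .refl H, hw.update hl (.cls lookup_cons_eq_none)
      (List.forall_mem_cons.2 ⟨hv, hw.attrs hl⟩), .num⟩
  | setFail hfail =>
    cases hd with
    | setDyn => rfl
    | set hu =>
      obtain ⟨a, ha⟩ := hu.value_obj
      rw [ha] at hu
      obtain ⟨S, hS, -⟩ := hu.addr_inv
      obtain ⟨h, hl⟩ := Finmap.mem_iff.1 (hw.mem_of_lookup hS)
      exact absurd ⟨a, h, ha, hl⟩ hfail

/-! ### Evaluation contexts -/

theorem Forall₂.exists_replace {α β : Type} {R : α → β → Prop} {l₁ l₂ : List α} {a : α}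
    {l' : List β} (h : List.Forall₂ R (l₁ ++ a :: l₂) l') :
    ∃ b, R a b ∧ ∀ (R' : α → β → Prop) (a' : α), (∀ x y, R x y → R' x y) → R' a' b →
      List.Forall₂ R' (l₁ ++ a' :: l₂) l' := by
  induction l₁ generalizing l' with
  | nil =>
    cases h with
    | cons h hs => exact ⟨_, h, fun R' a' hR ha => .cons ha (hs.imp hR)⟩
  | cons x l₁ ih =>
    cases h with
    | cons h hs =>
      obtain ⟨b, hb, hrep⟩ := ih hs
      exact ⟨b, hb, fun R' a' hR ha => .cons (hR _ _ h) (hrep R' a' hR ha)⟩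

theorem forall_mem_replace {α : Type} {P Q : α → Prop} {l₁ l₂ : List α} {a a' : α}
    (h : ∀ x ∈ l₁ ++ a :: l₂, P x) (hPQ : ∀ x, P x → Q x) (ha' : Q a') :
    ∀ x ∈ l₁ ++ a' :: l₂, Q x := by
  simp only [List.mem_append, List.mem_cons] at h ⊢
  rintro x (hx | rfl | hx)
  · exact hPQ x (h x (.inl hx))
  · exact ha'
  · exact hPQ x (h x (.inr (.inr hx)))

theorem memberLabels_replace (ms₁ ms₂ : List (Label × Expr)) (l : Label) (e e' : Expr) :
    memberLabels (ms₁ ++ (l, e') :: ms₂) = memberLabels (ms₁ ++ (l, e) :: ms₂) := by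
  simp [memberLabels]

/-- The expression in the hole of a typed expression has a tag, and may be replaced by any
expression of the same tag under a finer heap type. -/
theorem ECtx.replace {H : HeapTy} {E : ECtx} {e : Expr} {S : Tag}
    (h : HasType H .empty (E.plug e) S) :
    ∃ T, HasType H .empty e T ∧ ∀ H' e', H.Refines H' → HasType H' .empty e' T →
      HasType H' .empty (E.plug e') S := by
  induction E generalizing S with
  | hole => exact ⟨S, h, fun _ _ _ h' => h'⟩
  | appFn E es p ih =>
    obtain ⟨S₀, hd, hle⟩ := h.exists_direct
    cases hd with
    | appDyn he hes =>
      obtain ⟨T, hT, hrep⟩ := ih he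
      exact ⟨T, hT, fun H' e' hr he' => .of_le
        (.appDyn (hrep H' e' hr he') fun a ha => (hes a ha).refine hr) hle⟩
    | app he hes =>
      obtain ⟨T, hT, hrep⟩ := ih he
      exact ⟨T, hT, fun H' e' hr he' => .of_le
        (.app (hrep H' e' hr he') (fun a ha => (hes a ha).refine hr) rfl) hle⟩
  | appArg v vs E es p ih =>
    obtain ⟨S₀, hd, hle⟩ := h.exists_direct
    cases hd with
    | appDyn he hes =>
      obtain ⟨T, hT, hrep⟩ := ih (hes (E.plug e) (by simp))
      exact ⟨T, hT, fun H' e' hr he' => .of_le (.appDyn (he.refine hr)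
        (forall_mem_replace hes (fun _ h => h.refine hr) (hrep H' e' hr he'))) hle⟩
    | app he hes =>
      obtain ⟨T, hT, hrep⟩ := ih (hes (E.plug e) (by simp))
      exact ⟨T, hT, fun H' e' hr he' => .of_le (.app (he.refine hr)
        (forall_mem_replace hes (fun _ h => h.refine hr) (hrep H' e' hr he')) (by simp)) hle⟩
  | get E l p ih =>
    obtain ⟨S₀, hd, hle⟩ := h.exists_direct
    cases hd with
    | getDyn he =>
      obtain ⟨T, hT, hrep⟩ := ih he
      exact ⟨T, hT, fun H' e' hr he' => .of_le (.getDyn (hrep H' e' hr he')) hle⟩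
    | get he =>
      obtain ⟨T, hT, hrep⟩ := ih he
      exact ⟨T, hT, fun H' e' hr he' => .of_le (.get (hrep H' e' hr he')) hle⟩
  | setL E l p e₂ ih =>
    obtain ⟨S₀, hd, hle⟩ := h.exists_direct
    cases hd with
    | setDyn he he₂ =>
      obtain ⟨T, hT, hrep⟩ := ih he
      exact ⟨T, hT, fun H' e' hr he' => .of_le
        (.setDyn (hrep H' e' hr he') (he₂.refine hr)) hle⟩
    | set he he₂ =>
      obtain ⟨T, hT, hrep⟩ := ih he
      exact ⟨T, hT, fun H' e' hr he' => .of_le (.set (hrep H' e' hr he') (he₂.refine hr)) hle⟩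
  | setR v l p E ih =>
    obtain ⟨S₀, hd, hle⟩ := h.exists_direct
    cases hd with
    | setDyn hv he =>
      obtain ⟨T, hT, hrep⟩ := ih he
      exact ⟨T, hT, fun H' e' hr he' => .of_le (.setDyn (hv.refine hr) (hrep H' e' hr he')) hle⟩
    | set hv he =>
      obtain ⟨T, hT, hrep⟩ := ih he
      exact ⟨T, hT, fun H' e' hr he' => .of_le (.set (hv.refine hr) (hrep H' e' hr he')) hle⟩
  | letIn x E e₂ ih =>
    obtain ⟨S₀, hd, hle⟩ := h.exists_direct
    cases hd with
    | letIn he he₂ =>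
      obtain ⟨T, hT, hrep⟩ := ih he
      exact ⟨T, hT, fun H' e' hr he' => .of_le
        (.letIn (hrep H' e' hr he') (he₂.refine hr)) hle⟩
  | check E S' ih =>
    obtain ⟨S₀, hd, hle⟩ := h.exists_direct
    cases hd with
    | check he =>
      obtain ⟨T, hT, hrep⟩ := ih he
      exact ⟨T, hT, fun H' e' hr he' => .of_le (.check (hrep H' e' hr he')) hle⟩
  | clsSuper vs E es ms c p ih =>
    obtain ⟨S₀, hd, hle⟩ := h.exists_direct
    cases hd with
    | clsDyn hs hms hc =>
      obtain ⟨T, hT, hrep⟩ := ih (hs (E.plug e) (by simp))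
      exact ⟨T, hT, fun H' e' hr he' => .of_le (.clsDyn
        (forall_mem_replace hs (fun _ h => h.refine hr) (hrep H' e' hr he'))
        (fun m hm => (hms m hm).refine hr) (hc.refine hr)) hle⟩
    | cls hs hms hc =>
      obtain ⟨δ, hδ, hs⟩ := Forall₂.exists_replace hs
      obtain ⟨T, hT, hrep⟩ := ih hδ
      exact ⟨T, hT, fun H' e' hr he' => .of_le (DirectType.hasType (.cls
        (hs _ _ (fun _ _ h => h.refine hr) (hrep H' e' hr he'))
        (fun m hm => (hms m hm).refine hr) (hc.refine hr))) hle⟩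
  | clsCtor vs ms E p ih =>
    obtain ⟨S₀, hd, hle⟩ := h.exists_direct
    cases hd with
    | clsDyn hs hms hc =>
      obtain ⟨T, hT, hrep⟩ := ih hc
      exact ⟨T, hT, fun H' e' hr he' => .of_le (.clsDyn (fun s h => (hs s h).refine hr)
        (fun m hm => (hms m hm).refine hr) (hrep H' e' hr he')) hle⟩
    | cls hs hms hc =>
      obtain ⟨T, hT, hrep⟩ := ih hc
      exact ⟨T, hT, fun H' e' hr he' => .of_le (DirectType.hasType (.cls
        (hs.imp fun _ _ h => h.refine hr)
        (fun m hm => (hms m hm).refine hr) (hrep H' e' hr he'))) hle⟩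
  | clsMember vs M l E ms v p ih =>
    obtain ⟨S₀, hd, hle⟩ := h.exists_direct
    cases hd with
    | clsDyn hs hms hc =>
      obtain ⟨T, hT, hrep⟩ := ih (hms (l, E.plug e) (by simp))
      refine ⟨T, hT, fun H' e' hr he' => .of_le ?_ hle⟩
      rw [← memberLabels_replace _ _ _ _ (E.plug e')]
      exact .clsDyn (fun s h => (hs s h).refine hr)
        (forall_mem_replace hms (fun _ h => h.refine hr) (hrep H' e' hr he')) (hc.refine hr)
    | cls hs hms hc =>
      obtain ⟨T, hT, hrep⟩ := ih (hms (l, E.plug e) (by simp))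
      refine ⟨T, hT, fun H' e' hr he' => .of_le ?_ hle⟩
      rw [← memberLabels_replace _ _ _ _ (E.plug e')]
      exact DirectType.hasType (.cls (hs.imp fun _ _ h => h.refine hr)
        (forall_mem_replace hms (fun _ h => h.refine hr) (hrep H' e' hr he')) (hc.refine hr))

theorem Step.ok {e : Expr} {μ : Heap} {r : Result} (h : Step e μ r) {H : HeapTy} {S : Tag}
    (hw : HeapWf H μ) (he : HasType H .empty e S) : r.Ok H S := by
  cases h with
  | step E hr =>
    obtain ⟨T, hT, hrep⟩ := ECtx.replace he
    obtain ⟨H', href, hw', he'⟩ := hr.ok hw hT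
    exact ⟨H', href, hw', hrep H' _ href he'⟩
  | pyError E hr =>
    obtain ⟨T, hT, -⟩ := ECtx.replace he
    have hp := hr.ok hw hT
    exact hp
  | castError => trivial

theorem Steps.ok {e : Expr} {μ : Heap} {r : Result} (h : Steps e μ r) {H : HeapTy} {S : Tag}
    (hw : HeapWf H μ) (he : HasType H .empty e S) : r.Ok H S := by
  induction h generalizing H with
  | refl => exact ⟨H, .refl H, hw, he⟩
  | pyError h => exact h.ok hw he
  | castError h => trivial
  | @chain e e' μ μ' r h _ ih =>
    obtain ⟨H', href, hw', he'⟩ := h.ok hw he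
    have hr := ih hw' he'
    cases r with
    | conf e μ =>
      obtain ⟨H'', href', h⟩ := hr
      exact ⟨H'', href.trans href', h⟩
    | castError => trivial
    | pyError => exact hr

/-! ### Progress -/

/-- Some redex of `e` in evaluation position reduces. -/
def Steppable (e : Expr) (μ : Heap) : Prop :=
  ∃ (E : ECtx) (e₀ : Expr) (r : Result), e = E.plug e₀ ∧ Red e₀ μ r

theorem Steppable.exists_step {e : Expr} {μ : Heap} (h : Steppable e μ) : ∃ r, Step e μ r := by
  obtain ⟨E, e₀, r, rfl, hr⟩ := h
  cases r with
  | conf e' μ' => exact ⟨_, .step E hr⟩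
  | castError => exact ⟨_, .castError E hr⟩
  | pyError p => exact ⟨_, .pyError E hr⟩

theorem Red.steppable {e : Expr} {μ : Heap} {r : Result} (h : Red e μ r) : Steppable e μ :=
  ⟨.hole, e, r, rfl, h⟩

theorem steppable_app (v : Value) (vs : List Value) (p : Origin) (μ : Heap) :
    Steppable (.app v.1 (vs.map Subtype.val) p) μ := by
  by_cases hf : ∃ xs e, v.1 = .fn xs e ∧ xs.length = vs.length
  · obtain ⟨xs, e, hv, hn⟩ := hf
    rw [hv]
    exact (Red.app hn).steppable
  by_cases hc : ∃ a as M c, v.1 = .addr a ∧ μ.lookup a = some (.cls as M c)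
  · obtain ⟨a, as, M, c, hv, hl⟩ := hc
    obtain ⟨a', ha'⟩ := Heap.exists_fresh μ
    rw [hv]
    exact (Red.appCls hl ha' (x := 0)).steppable
  · exact (Red.appFail hf hc).steppable

theorem steppable_get (v : Value) (l : Label) (p : Origin) (μ : Heap) :
    Steppable (.get v.1 l p) μ := by
  by_cases h : ∃ a h r, v.1 = .addr a ∧ μ.lookup a = some h ∧ Lookup μ a l p h r
  · obtain ⟨a, h, r, hv, ha, hr⟩ := h
    rw [hv]
    exact (Red.get ha hr).steppable
  · exact (Red.getFail h).steppable

theorem steppable_set (u v : Value) (l : Label) (p : Origin) (μ : Heap) :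
    Steppable (.set u.1 l p v.1) μ := by
  by_cases h : ∃ a h, u.1 = .addr a ∧ μ.lookup a = some h
  · obtain ⟨a, h, hu, ha⟩ := h
    rw [hu]
    cases h with
    | cls => exact (Red.setCls ha).steppable
    | obj => exact (Red.setObj ha).steppable
  · exact (Red.setFail h).steppable

theorem steppable_check (v : Value) (S : Tag) (μ : Heap) : Steppable (.check v.1 S) μ := by
  by_cases h : Check μ v.1 S
  · exact (Red.check h).steppable
  · exact (Red.checkFail h).steppable

theorem steppable_cls (vs : List Value) (M : List (Label × Value)) (v : Value) (p : Origin)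
    (μ : Heap) : Steppable (.cls (vs.map Subtype.val) (valueMembers M) v.1 p) μ := by
  by_cases h : (∀ u ∈ vs, ∃ a as' M' v', u.1 = .addr a ∧
      μ.lookup a = some (.cls as' M' v')) ∧ ParamMatch μ v.1 .any
  · obtain ⟨hs, hp⟩ := h
    obtain ⟨as, has, hl⟩ : ∃ as : List Addr, vs.map Subtype.val = as.map .addr ∧
        ∀ a ∈ as, ∃ as' M' v', μ.lookup a = some (.cls as' M' v') := by
      clear hp
      induction vs with
      | nil => exact ⟨[], rfl, by simp⟩
      | cons u vs ih =>
        obtain ⟨⟨a, as', M', v', hu, hl⟩, hs⟩ := List.forall_mem_cons.1 hs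
        obtain ⟨as, has, hl'⟩ := ih hs
        exact ⟨a :: as, by simp [hu, has], List.forall_mem_cons.2 ⟨⟨as', M', v', hl⟩, hl'⟩⟩
    obtain ⟨a', ha'⟩ := Heap.exists_fresh μ
    rw [has]
    exact (Red.cls hl hp ha').steppable
  · exact (Red.clsFail h).steppable

theorem values_or_steppable {es : List Expr} {μ : Heap}
    (h : ∀ e ∈ es, e.IsValue ∨ Steppable e μ) :
    (∃ vs : List Value, es = vs.map Subtype.val) ∨
      ∃ (vs : List Value) (e : Expr) (es' : List Expr),
        es = vs.map Subtype.val ++ e :: es' ∧ Steppable e μ := by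
  induction es with
  | nil => exact .inl ⟨[], rfl⟩
  | cons e es ih =>
    obtain ⟨he, hes⟩ := List.forall_mem_cons.1 h
    rcases he with he | he
    · rcases ih hes with ⟨vs, rfl⟩ | ⟨vs, e', es', rfl, he'⟩
      · exact .inl ⟨⟨e, he⟩ :: vs, rfl⟩
      · exact .inr ⟨⟨e, he⟩ :: vs, e', es', rfl, he'⟩
    · exact .inr ⟨[], e, es, rfl, he⟩

theorem valueMembers_or_steppable {ms : List (Label × Expr)} {μ : Heap}
    (h : ∀ m ∈ ms, m.2.IsValue ∨ Steppable m.2 μ) :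
    (∃ M : List (Label × Value), ms = valueMembers M) ∨
      ∃ (M : List (Label × Value)) (l : Label) (e : Expr) (ms' : List (Label × Expr)),
        ms = valueMembers M ++ (l, e) :: ms' ∧ Steppable e μ := by
  induction ms with
  | nil => exact .inl ⟨[], rfl⟩
  | cons m ms ih =>
    obtain ⟨l, e⟩ := m
    obtain ⟨he, hms⟩ := List.forall_mem_cons.1 h
    rcases he with he | he
    · rcases ih hms with ⟨M, rfl⟩ | ⟨M, l', e', ms', rfl, he'⟩
      · exact .inl ⟨(l, ⟨e, he⟩) :: M, rfl⟩
      · exact .inr ⟨(l, ⟨e, he⟩) :: M, l', e', ms', rfl, he'⟩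
    · exact .inr ⟨[], l, e, ms, rfl, he⟩

theorem progress_app {e : Expr} {es : List Expr} {μ : Heap} (p : Origin)
    (he : e.IsValue ∨ Steppable e μ) (hes : ∀ e ∈ es, e.IsValue ∨ Steppable e μ) :
    Steppable (.app e es p) μ := by
  rcases he with he | ⟨E, e₀, r, rfl, hr⟩
  · rcases values_or_steppable hes with ⟨vs, rfl⟩ | ⟨vs, _, es', rfl, E, e₀, r, rfl, hr⟩
    · exact steppable_app ⟨e, he⟩ vs p μ
    · exact ⟨.appArg ⟨e, he⟩ vs E es' p, e₀, r, rfl, hr⟩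
  · exact ⟨.appFn E es p, e₀, r, rfl, hr⟩

theorem progress_get {e : Expr} {μ : Heap} (l : Label) (p : Origin)
    (he : e.IsValue ∨ Steppable e μ) : Steppable (.get e l p) μ := by
  rcases he with he | ⟨E, e₀, r, rfl, hr⟩
  · exact steppable_get ⟨e, he⟩ l p μ
  · exact ⟨.get E l p, e₀, r, rfl, hr⟩

theorem progress_set {e e' : Expr} {μ : Heap} (l : Label) (p : Origin)
    (he : e.IsValue ∨ Steppable e μ) (he' : e'.IsValue ∨ Steppable e' μ) :
    Steppable (.set e l p e') μ := by
  rcases he with he | ⟨E, e₀, r, rfl, hr⟩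
  · rcases he' with he' | ⟨E, e₀, r, rfl, hr⟩
    · exact steppable_set ⟨e, he⟩ ⟨e', he'⟩ l p μ
    · exact ⟨.setR ⟨e, he⟩ l p E, e₀, r, rfl, hr⟩
  · exact ⟨.setL E l p e', e₀, r, rfl, hr⟩

theorem progress_cls {ss : List Expr} {ms : List (Label × Expr)} {c : Expr} {μ : Heap}
    (p : Origin) (hs : ∀ e ∈ ss, e.IsValue ∨ Steppable e μ)
    (hms : ∀ m ∈ ms, m.2.IsValue ∨ Steppable m.2 μ) (hc : c.IsValue ∨ Steppable c μ) :
    Steppable (.cls ss ms c p) μ := by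
  rcases values_or_steppable hs with ⟨vs, rfl⟩ | ⟨vs, _, es', rfl, E, e₀, r, rfl, hr⟩
  · rcases hc with hc | ⟨E, e₀, r, rfl, hr⟩
    · rcases valueMembers_or_steppable hms with
        ⟨M, rfl⟩ | ⟨M, l, _, ms', rfl, E, e₀, r, rfl, hr⟩
      · exact steppable_cls vs M ⟨c, hc⟩ p μ
      · exact ⟨.clsMember vs M l E ms' ⟨c, hc⟩ p, e₀, r, rfl, hr⟩
    · exact ⟨.clsCtor vs ms E p, e₀, r, rfl, hr⟩
  · exact ⟨.clsSuper vs E es' ms c p, e₀, r, rfl, hr⟩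

theorem HasType.progress {H : HeapTy} {e : Expr} {S : Tag} (h : HasType H .empty e S)
    (μ : Heap) : e.IsValue ∨ Steppable e μ := by
  generalize hΓ : (Env.empty : Env Tag) = Γ at h
  induction h with
  | sub _ _ ih => exact ih hΓ
  | var h => subst hΓ; cases h
  | addr => exact .inl (.addr _)
  | num => exact .inl (.num _)
  | appDyn _ _ ih ih' => exact .inr (progress_app _ (ih hΓ) fun e he => ih' e he hΓ)
  | app _ _ _ ih ih' => exact .inr (progress_app _ (ih hΓ) fun e he => ih' e he hΓ)
  | getDyn _ ih => exact .inr (progress_get _ _ (ih hΓ))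
  | get _ ih => exact .inr (progress_get _ _ (ih hΓ))
  | setDyn _ _ ih ih' => exact .inr (progress_set _ _ (ih hΓ) (ih' hΓ))
  | set _ _ ih ih' => exact .inr (progress_set _ _ (ih hΓ) (ih' hΓ))
  | clsDyn _ _ _ ih ih' ihc =>
    exact .inr (progress_cls _ (fun s hs => ih s hs hΓ) (fun m hm => ih' m hm hΓ) (ihc hΓ))
  | cls hl _ _ _ ih ih' ihc =>
    refine .inr (progress_cls _ (fun s hs => ?_) (fun m hm => ih' m hm hΓ) (ihc hΓ))
    obtain ⟨i, hi, rfl⟩ := List.getElem_of_mem hs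
    exact ih i hi (hl ▸ hi) hΓ
  | fn => exact .inl (.fn _ _)
  | @check _ e S _ ih =>
    rcases ih hΓ with he | ⟨E, e₀, r, rfl, hr⟩
    · exact .inr (steppable_check ⟨e, he⟩ S μ)
    · exact .inr ⟨.check E S, e₀, r, rfl, hr⟩
  | @letIn _ x e e' _ _ _ _ ih =>
    rcases ih hΓ with he | ⟨E, e₀, r, rfl, hr⟩
    · exact .inr (Red.letIn (v := ⟨e, he⟩)).steppable
    · exact .inr ⟨.letIn x E e', e₀, r, rfl, hr⟩

/-! ### Typing of translated programs -/

theorem Env.tags_extend (Γ : Env Ty) (ps : List (Var × Ty)) :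
    (Γ.extend ps).tags = Γ.tags.extend (ps.map fun p => (p.1, p.2.tag)) :=
  Env.extend_map Ty.tag Γ ps

theorem Env.tags_bind (Γ : Env Ty) (x : Var) (A : Ty) :
    (Γ.bind x A).tags = Γ.tags.bind x A.tag :=
  Env.bind_map Ty.tag Γ x A

theorem HasType.checkParams {H : HeapTy} {Γ : Env Tag} {ps : List (Var × Ty)} {e : Expr}
    {S : Tag} (hps : ∀ p ∈ ps, ∃ T, Γ p.1 = some T)
    (h : HasType H (Γ.extend (ps.map fun p => (p.1, p.2.tag))) e S) :
    HasType H Γ (checkParams ps e) S := by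
  induction ps generalizing Γ with
  | nil => exact h
  | cons p ps ih =>
    obtain ⟨⟨T, hT⟩, hps⟩ := List.forall_mem_cons.1 hps
    refine .letIn (.check (HasType.var hT).pyobj) (ih (fun q hq => ?_) h)
    simp only [Env.bind]
    split
    · exact ⟨_, rfl⟩
    · exact hps q hq

theorem HasType.fn_checkParams {H : HeapTy} {Γ : Env Ty} {ps : List (Var × Ty)} {e : Expr}
    {S : Tag} (h : HasType H (Γ.extend ps).tags e S) :
    HasType H Γ.tags (.fn (ps.map Prod.fst) (Anthill.checkParams ps e)) (.fn ps.length) := by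
  rw [← List.length_map (f := Prod.fst) (as := ps)]
  refine .fn (.checkParams (fun p hp => ⟨_, Env.extend_const _ _ (List.mem_map_of_mem hp)⟩) ?_)
  refine h.pyobj.mono (.refl H) fun x T hx => ?_
  rw [Env.tags_extend] at hx
  by_cases hm : x ∈ (ps.map fun p => (p.1, p.2.tag)).map Prod.fst
  · rwa [Env.extend_eq_of_mem _ Γ.tags hm]
  · rw [Env.extend_eq_of_notMem hm] at hx ⊢
    rwa [Env.extend_eq_of_notMem (by simpa [Function.comp_def] using hm)]

theorem Attrs.mem_dom_iff {Δ : Attrs} {x : Label} : x ∈ Δ.dom ↔ ∃ A, Δ.lookup x = some A := by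
  rw [← Option.ne_none_iff_exists', Ne, List.lookup_eq_none_iff]
  simp only [dom, List.mem_toFinset, List.mem_map]
  constructor
  · rintro ⟨p, hp, rfl⟩ h
    exact absurd (h p hp) (by simp)
  · intro h
    by_contra! hn
    exact h fun p hp => by simpa using fun hx => hn p hp hx.symm

theorem Ty.tag_le_obj {A A' : Ty} {Δ : Attrs} {l : Label} (hΔ : A.mems = some Δ)
    (hl : Δ.lookup l = some A') : A.tag.Le (.obj {l}) := by
  have hd : {l} ⊆ Δ.dom := Finset.singleton_subset_iff.2 (Attrs.mem_dom_iff.2 ⟨A', hl⟩)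
  cases A with
  | dyn => cases hΔ; cases hl
  | int => cases hΔ
  | fn => cases hΔ
  | cls => cases hΔ; exact hd
  | obj => cases hΔ; exact hd

theorem Tag.obj_le_empty {δ : Finset Label} : (Tag.obj δ).Le (.obj ∅) :=
  Finset.empty_subset δ

theorem HasType.translated_cls {Γ : Env Tag} {q : Openness} {Δ₁ Δ₂ : Attrs} {es : List Expr}
    {Δs : List Attrs} {ems efs : List (Label × Expr)} {Ams Afs : List (Label × Ty)} {ec : Expr}
    {Acs : List Ty} (hlen : es.length = Δs.length) (hes : ∀ e ∈ es, HasType ∅ Γ e .pyobj)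
    (hc : HasType ∅ Γ ec (.fn (Acs.length + 1)))
    (hlm : ems.map Prod.fst = Ams.map Prod.fst) (hms : ∀ m ∈ ems, HasType ∅ Γ m.2 .pyobj)
    (hlf : efs.map Prod.fst = Afs.map Prod.fst) (hfs : ∀ m ∈ efs, HasType ∅ Γ m.2 .pyobj)
    (hΔ : ∀ x B, Δ₁.lookup x = some B → ∃ B', (x, B') ∈ Afs ∨ (x, B') ∈ Ams ∨
      ∃ Δ ∈ Δs, Δ.lookup x = some B') :
    HasType ∅ Γ (.cls (List.zipWith (fun e Δ => .check e (.cls (Attrs.dom Δ) .any)) es Δs)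
      (ems ++ efs) ec .typed) (Ty.cls q Δ₁ Δ₂ Acs).tag := by
  have hs : List.Forall₂ (fun s δ => HasType ∅ Γ s (.cls δ .any))
      (List.zipWith (fun e Δ => .check e (.cls (Attrs.dom Δ) .any)) es Δs)
      (Δs.map Attrs.dom) := by
    rw [forall₂_iff_getElem]
    refine ⟨by simp [hlen], fun i h h' => ?_⟩
    simp only [List.getElem_zipWith, List.getElem_map]
    exact .check (hes _ (List.getElem_mem _))
  have hms' : ∀ m ∈ ems ++ efs, HasType ∅ Γ m.2 .pyobj := fun m hm =>
    (List.mem_append.1 hm).elim (hms m) (hfs m)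
  refine (DirectType.cls hs hms' hc).hasType.of_le ⟨fun x hx => ?_, .inl rfl⟩
  obtain ⟨B, hB⟩ := Attrs.mem_dom_iff.1 hx
  rw [Finset.mem_union, mem_foldr_union, memberLabels, List.mem_toFinset, List.map_append,
    hlm, hlf, List.mem_append]
  obtain ⟨B', h | h | ⟨Δ, hmem, h⟩⟩ := hΔ x B hB
  · exact .inl (.inr (List.mem_map.2 ⟨_, h, rfl⟩))
  · exact .inl (.inl (List.mem_map.2 ⟨_, h, rfl⟩))
  · exact .inr ⟨Δ.dom, List.mem_map_of_mem hmem, Attrs.mem_dom_iff.2 ⟨B', h⟩⟩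

mutual

theorem Translates.hasType {Γ : Env Ty} {t : Term} {e : Expr} {A : Ty} :
    Translates Γ t e A → HasType ∅ Γ.tags e A.tag
  | .var h => .var (by simp [Env.tags, h])
  | .num => .num
  | .letIn h₁ h₂ => .letIn h₁.hasType (Env.tags_bind .. ▸ h₂.hasType)
  | .get h hΔ hl => .check (.get (h.hasType.of_le (Ty.tag_le_obj hΔ hl)))
  | .getCheck h _ _ _ => .get (.check h.hasType.pyobj)
  | .set h₁ h₂ hΔ hl _ =>
    .set (h₁.hasType.of_le ((Ty.tag_le_obj hΔ hl).trans Tag.obj_le_empty))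
      (.pyobj (.check h₂.hasType.pyobj))
  | .setCheck h₁ h₂ _ _ _ => .set (.check h₁.hasType.pyobj) h₂.hasType.pyobj
  | .fn (ps := ps) h _ => by
    simpa only [Ty.tag, List.length_map] using h.hasType.fn_checkParams
  | .appDyn h hs => by
    obtain ⟨hn, hn', hes⟩ := hs.hasType
    exact .app (.check h.hasType) hes (hn.trans hn'.symm)
  | .appFn h hs hlen _ => by
    obtain ⟨hn, hn', hes⟩ := hs.hasType
    exact .check (.app h.hasType hes (hn.trans hlen.symm))
  | .appCtor h hs hlen _ _ => by
    obtain ⟨hn, hn', hes⟩ := hs.hasType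
    exact .check (.app (h.hasType.of_le rfl) hes (hn.trans hlen.symm))
  | .cls hs hc hm hf hΔs hΔ => by
    obtain ⟨hn, hn', hes⟩ := hs.hasType
    obtain ⟨hlm, hms⟩ := hm.hasType
    obtain ⟨hlf, hfs⟩ := hf.hasType
    have hlen := congrArg List.length hΔs
    simp only [List.length_map] at hlen
    exact .translated_cls (hn.trans (hn'.symm.trans hlen)) hes hc.hasType hlm hms hlf hfs
      fun x B hB => (hΔ x B hB).imp fun _ => And.left

theorem TranslatesList.hasType {Γ : Env Ty} {ts : List Term} {es : List Expr} {As : List Ty} :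
    TranslatesList Γ ts es As → es.length = ts.length ∧ As.length = ts.length ∧
      ∀ e ∈ es, HasType ∅ Γ.tags e .pyobj
  | .nil => by simp
  | .cons h hs => by
    obtain ⟨hn, hn', hes⟩ := hs.hasType
    exact ⟨by simp [hn], by simp [hn'], List.forall_mem_cons.2 ⟨h.hasType.pyobj, hes⟩⟩

theorem TranslatesFields.hasType {Γ : Env Ty} {fs : List (Label × Term)}
    {es : List (Label × Expr)} {As : List (Label × Ty)} :
    TranslatesFields Γ fs es As → es.map Prod.fst = As.map Prod.fst ∧
      ∀ m ∈ es, HasType ∅ Γ.tags m.2 .pyobj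
  | .nil => by simp
  | .cons h hs => by
    obtain ⟨hl, hes⟩ := hs.hasType
    exact ⟨by simp [hl], List.forall_mem_cons.2 ⟨h.hasType.pyobj, hes⟩⟩

theorem TranslatesMethods.hasType {Γ : Env Ty} {Ac : Ty} {ms : List (Label × Method)}
    {es : List (Label × Expr)} {As : List (Label × Ty)} :
    TranslatesMethods Γ Ac ms es As → es.map Prod.fst = As.map Prod.fst ∧
      ∀ m ∈ es, HasType ∅ Γ.tags m.2 .pyobj
  | .nil => by simp
  | .cons h hs => by
    obtain ⟨hl, hes⟩ := hs.hasType
    exact ⟨by simp [hl], List.forall_mem_cons.2 ⟨h.hasType, hes⟩⟩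

theorem TranslatesCtor.hasType {Γ : Env Ty} {c : Ctor} {e : Expr} {As : List Ty} :
    TranslatesCtor Γ c e As → HasType ∅ Γ.tags e (.fn (As.length + 1))
  | .mk (xs := xs) (ps := ps) h => by
    have hb := h.hasType.fn_checkParams.fn_inv.1
    rw [List.length_map, ← List.length_map (f := Prod.fst) (as := ps)]
    rw [Env.tags_bind] at hb
    exact .fn hb

theorem TranslatesMethod.hasType {Γ : Env Ty} {Ac A : Ty} {m : Method} {e : Expr} :
    TranslatesMethod Γ Ac m e A → HasType ∅ Γ.tags e .pyobj
  | .mk (xs := xs) (ps := ps) (Ao := Ao) _ _ h =>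
    (HasType.fn_checkParams (ps := (xs, Ao) :: ps) h.hasType).pyobj

end

/-! ### Untyped contexts -/

theorem CtxType.hasType {Γ Γ' : Env Tag} {S S' : Tag} {C : Ctx} {e : Expr}
    (h : CtxType Γ S C Γ' S') (he : HasType ∅ Γ e S) : HasType ∅ Γ' (C.plug e) S' := by
  have happ : ∀ {P : Expr → Prop} {l₁ l₂ : List Expr} {a : Expr}, (∀ x ∈ l₁, P x) →
      (∀ x ∈ l₂, P x) → P a → ∀ x ∈ l₁ ++ a :: l₂, P x :=
    fun h₁ h₂ ha => List.forall_mem_append.2 ⟨h₁, List.forall_mem_cons.2 ⟨ha, h₂⟩⟩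
  induction h with
  | hole => exact he
  | sub _ hs ih => exact .sub ih hs
  | appFn _ hes ih => exact .appDyn ih hes
  | appArg h h₁ h₂ _ ih => exact .appDyn h (happ h₁ h₂ ih)
  | get _ ih => exact .getDyn ih
  | setL _ h ih => exact .setDyn ih h
  | setR h _ ih => exact .setDyn h ih
  | clsSuper h₁ h₂ hms hc _ ih => exact (HasType.clsDyn (happ h₁ h₂ ih) hms hc).pyobj
  | clsMember hs h₁ h₂ hc _ ih =>
    exact (HasType.clsDyn hs (List.forall_mem_append.2
      ⟨h₁, List.forall_mem_cons.2 ⟨ih, h₂⟩⟩) hc).pyobj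
  | clsCtor hs hms _ ih => exact (HasType.clsDyn hs hms ih).pyobj
  | fn _ ih => exact .fn ih
  | check _ ih => exact .check ih
  | letL _ h ih => exact .letIn ih h
  | letR h _ ih => exact .letIn h ih

/-! ### Soundness -/

theorem HasType.not_steps_typed {e : Expr} {S : Tag} (h : HasType ∅ .empty e S) :
    ¬ Steps e ∅ (.pyError .typed) := by
  intro hs
  cases (hs.ok heapWf_empty h : Origin.typed = .untyped)

theorem HasType.sound {e : Expr} {S : Tag} (h : HasType ∅ .empty e S) :
    (∃ (v : Value) (H : HeapTy) (μ : Heap),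
        Steps e ∅ (.conf v.1 μ) ∧ HasType H .empty v.1 S ∧ HeapOk H μ) ∨
      Steps e ∅ (.pyError .untyped) ∨ Steps e ∅ .castError ∨
      ∀ r, Steps e ∅ r → ∃ (e' : Expr) (μ' : Heap), r = .conf e' μ' ∧ ∃ r', Step e' μ' r' := by
  by_contra! hn
  obtain ⟨hval, herr, hcast, r, hr, hstuck⟩ := hn
  have hok := hr.ok heapWf_empty h
  cases r with
  | castError => exact hcast hr
  | pyError p =>
    cases (hok : p = .untyped)
    exact herr hr
  | conf e' μ' =>
    obtain ⟨H, -, hw, he'⟩ := hok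
    rcases he'.progress μ' with hv | hs
    · exact hval ⟨e', hv⟩ H μ' hr he' hw.ok
    · obtain ⟨r', hr'⟩ := hs.exists_step
      exact hstuck e' μ' rfl r' hr'

end Anthill

theorem theorem1 (Γ : Anthill.Env Anthill.Ty) (t : Anthill.Term) (e : Anthill.Expr)
    (A : Anthill.Ty) (ht : Anthill.Translates Γ t e A)
    (C : Anthill.Ctx) (S : Anthill.Tag)
    (hC : Anthill.CtxType Γ.tags A.tag C Anthill.Env.empty S) :
    Anthill.HasType ∅ Anthill.Env.empty (C.plug e) S ∧
    ((∃ (v : Anthill.Value) (H : Anthill.HeapTy) (μ : Anthill.Heap),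
        Anthill.Steps (C.plug e) ∅ (.conf v.1 μ) ∧
        Anthill.HasType H Anthill.Env.empty v.1 S ∧ Anthill.HeapOk H μ) ∨
      Anthill.Steps (C.plug e) ∅ (.pyError .untyped) ∨
      Anthill.Steps (C.plug e) ∅ .castError ∨
      (∀ r, Anthill.Steps (C.plug e) ∅ r →
        ∃ (e' : Anthill.Expr) (μ' : Anthill.Heap), r = .conf e' μ' ∧
          ∃ r', Anthill.Step e' μ' r')) ∧
    ¬ Anthill.Steps (C.plug e) ∅ (.pyError .typed) := by
  have h := hC.hasType ht.hasType
  exact ⟨h, h.sound, h.not_steps_typed⟩
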